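/- **Model.** There are $n$ processes. Each process $i$ has a FIFO store buffer and a local dispatcher $d_i$; processes and dispatchers are called agents. A TSO state consists of a memory $\mathsf m:\mathsf{Var}\to\mathsf{Val}$ and the $n$ buffers. A process can write (append $(x,v)$ to its buffer), read $x$ (event $\mathtt{RfB}$: the latest item for $x$ in its own buffer is returned; event $\mathtt{RfM}$, if its buffer has no item for $x$: the value $\mathsf m(x)$ is returned), perform a fence $\mathtt F$ (enabled only if its buffer is empty), perform $\mathtt{RMW}(x,v_{\rm exp},v_{\rm new})$ (enabled only if its buffer is empty and $\mathsf m(x)=v_{\rm exp}$; sets $\mathsf m(x)=v_{\rm new}$), perform internal actions, among them $\mathtt{return}(O)$ for operation names $O$, or do nothing ($\bot$). A dispatcher $d_i$ can perform $\mathtt{prop}$ (enabled only if the buffer of $i$ is nonempty; removes the oldest item $(x,v)$ and sets $\mathsf m(x)=v$) or do nothing. The item created by the $k$-th write of $i$ has tag $\langle i,k\rangle$; this is also the tag of that write, of every $\mathtt{RfB}$ that reads the item, and of the $\mathtt{prop}$ that propagates it. $\mathtt{RfM}$, $\mathtt{RMW}$ and $\mathtt{prop}$ events are memory accesses of their variable.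 The local state of a process is the list of records of its non-null actions (a read is recorded with its value, but not its source) and of the operations invoked at it. A *run* is a sequence of global states (a TSO state and the local states) at times $0,1,2,\dots$ that starts with empty buffers and empty local states. In round $t+1$, which leads from time $t$ to time $t+1$, each agent $b$ performs one action that is enabled at time $t$, called the action at the node $\langle b,t\rangle$, and the environment invokes at most one operation at each process. The actions take effect one by one, those of the processes first, then those of the dispatchers, and then the invocations. The actions of a round contain no two conflicting memory accesses (accesses of the same variable, not both $\mathtt{RfM}$, and not a $\mathtt{prop}$ by $d_i$ together with an $\mathtt{RfM}$ by $i$), and $d_i$ does not propagate an item in a round in which $i$ reads that item from its buffer. No operation is invoked at a process before the previously invoked one has returned. A protocol $P$ assigns to each process and local state a nonempty set of actions; $r$ is a run of $P$ if every non-null action of a process belongs to the set that $P$ assigns to its local state at that time. Runs $r,r'$ are *locally equivalent*, $r\approx r'$, if for every process the same local states appear in $r$ and in $r'$. *Occurs before* in $r$ is the least transitive relation $\rightsquigarrow_r$ on nodes such that, for all times $t<t'$, agents $b,c$ and processes $i$: (1) $\langle b,t\rangle\rightsquigarrow_r\langle b,t'\rangle$; (2) $\langle i,t\rangle\rightsquigarrow_r\langle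 d_i,t'\rangle$ if the action at $\langle i,t\rangle$ is a write or $\mathtt{RfB}$ and the one at $\langle d_i,t'\rangle$ is a $\mathtt{prop}$ with the same tag; (3) $\langle b,t\rangle\rightsquigarrow_r\langle c,t'\rangle$ if both actions are memory accesses of the same variable, unless both are $\mathtt{RfM}$, or $b=d_j$, $c=j$ for some process $j$ and the actions are a $\mathtt{prop}$ and an $\mathtt{RfM}$ respectively; (4) $\langle d_i,t\rangle\rightsquigarrow_r\langle i,t'\rangle$ if the action at $\langle d_i,t\rangle$ is $\mathtt{prop}$ and the one at $\langle i,t'\rangle$ is $\mathtt F$ or $\mathtt{RMW}$. An (occurrence of an) *operation* $X$ of process $i$ that is invoked in round $t_s+1$ and whose matching return is performed by $i$ in round $t_e$ has $X.s=\langle i,t_s\rangle$ and $X.e=\langle i,t_e\rangle$; what happens at times $t$ with $t_s\le t<t_e$ happens *during* $X$, and what happens at times $t<t_e$ happens *before* $X.e$. It *contains a feedback loop* in $r$ if there is a node $\langle b,t\rangle$ with $b\notin\{i,d_i\}$ and $X.s\rightsquigarrow_r\langle b,t\rangle\rightsquigarrow_r X.e$. A run of $P$ is *fair* if a dispatcher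 whose buffer is nonempty eventually propagates, and a process that from some time on always has an enabled non-null action according to $P$ eventually moves. **Theorem.** Let $r$ be a run of a protocol $P$, and let $X$ be a completed operation of process $i$ in $r$ during which $i$ writes a tag $\kappa$. If 1. $X$ does not contain a feedback loop in $r$, and 2. $i$ does not perform an $\mathtt F$ or $\mathtt{RMW}$ action during $X$, then there is a run $r'$ of $P$ with $r'\approx r$ and with the same initial state in which $X$ (the operation of $i$ with the same name and the same index in the sequence of invocations at $i$) also completes, $\kappa$ is also written during $X$, and $\kappa$ is not propagated to memory before $X.e$. If $r$ is fair, then $r'$ can be chosen fair. -/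

import Mathlib

namespace TSO

/-- The agents: every process `i` comes with a local dispatcher `disp i`. -/
inductive Agent (n : ℕ) where
  | proc (i : Fin n)
  | disp (i : Fin n)
  deriving DecidableEq

/-- The actions that a protocol can prescribe to a process. `Op` is the type of operation names,
`Inn` the type of (further) internal actions, which do not touch the TSO state. -/
inductive Action (Var Val Op Inn : Type*) where
  | read (x : Var)
  | write (x : Var) (v : Val)
  | fence
  | rmw (x : Var) (vexp vnew : Val)
  | ret (o : Op)
  | inner (a : Inn)
  | null

/-- The records that make up a local state. A read is recorded with the value returned, but not
with its source (buffer or memory). -/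
inductive Record (Var Val Op Inn : Type*) where
  | read (x : Var) (v : Val)
  | write (x : Var) (v : Val)
  | fence
  | rmw (x : Var) (vexp vnew : Val)
  | ret (o : Op)
  | inner (a : Inn)
  | invoke (o : Op)

/-- The local state of a process: the history of its observations, oldest first. -/
abbrev LocalState (Var Val Op Inn : Type*) := List (Record Var Val Op Inn)

/-- What an agent does at a node. The natural number in `W`, `RfB` and `prop` is the tag of the item
that is written, read from the buffer, or propagated: at process `i` or dispatcher `disp i`,
the number `k` stands for the tag `⟨i, k⟩`, i.e. for the item created by the `k`-th write of `i`
(counted from `0`). -/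
inductive Event (Var Val Op Inn : Type*) where
  | W (x : Var) (v : Val) (k : ℕ)
  | RfB (x : Var) (v : Val) (k : ℕ)
  | RfM (x : Var) (v : Val)
  | RMW (x : Var) (vexp vnew : Val)
  | F
  | ret (o : Op)
  | inner (a : Inn)
  | prop (x : Var) (v : Val) (k : ℕ)
  | null

/-- An item of a store buffer; `tag` is the index of the write that created it. The tag is
bookkeeping only: no precondition depends on it. -/
structure Item (Var Val : Type*) where
  var : Var
  val : Val
  tag : ℕ

/-- A basic TSO state: the main memory and one store buffer for each process (oldest item first). -/
structure State (n : ℕ) (Var Val : Type*) where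
  mem : Var → Val
  buf : Fin n → List (Item Var Val)

/-- The transition of the TSO state that is caused by a single event at a single agent. -/
inductive Step {n : ℕ} {Var Val Op Inn : Type*} [DecidableEq Var] :
    State n Var Val → Agent n → Event Var Val Op Inn → State n Var Val → Prop
  | write (σ : State n Var Val) (i : Fin n) (x : Var) (v : Val) (k : ℕ) :
      Step σ (.proc i) (.W x v k)
        ⟨σ.mem, Function.update σ.buf i (σ.buf i ++ [⟨x, v, k⟩])⟩
  | readBuf (σ : State n Var Val) (i : Fin n) (x : Var) (v : Val) (k : ℕ)
      (β₁ β₂ : List (Item Var Val)) (hbuf : σ.buf i = β₁ ++ ⟨x, v, k⟩ :: β₂)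
      (hlast : ∀ c ∈ β₂, c.var ≠ x) :
      Step σ (.proc i) (.RfB x v k) σ
  | readMem (σ : State n Var Val) (i : Fin n) (x : Var)
      (hbuf : ∀ c ∈ σ.buf i, c.var ≠ x) :
      Step σ (.proc i) (.RfM x (σ.mem x)) σ
  | rmw (σ : State n Var Val) (i : Fin n) (x : Var) (vexp vnew : Val)
      (hbuf : σ.buf i = []) (hmem : σ.mem x = vexp) :
      Step σ (.proc i) (.RMW x vexp vnew) ⟨Function.update σ.mem x vnew, σ.buf⟩
  | fence (σ : State n Var Val) (i : Fin n) (hbuf : σ.buf i = []) :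
      Step σ (.proc i) .F σ
  | propagate (σ : State n Var Val) (i : Fin n) (x : Var) (v : Val) (k : ℕ)
      (β : List (Item Var Val)) (hbuf : σ.buf i = ⟨x, v, k⟩ :: β) :
      Step σ (.disp i) (.prop x v k)
        ⟨Function.update σ.mem x v, Function.update σ.buf i β⟩
  | ret (σ : State n Var Val) (i : Fin n) (o : Op) : Step σ (.proc i) (.ret o) σ
  | inner (σ : State n Var Val) (i : Fin n) (a : Inn) : Step σ (.proc i) (.inner a) σ
  | null (σ : State n Var Val) (b : Agent n) : Step σ b .null σ

/-- Performing a list of events one by one. -/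
inductive StepSeq {n : ℕ} {Var Val Op Inn : Type*} [DecidableEq Var] :
    State n Var Val → List (Agent n × Event Var Val Op Inn) → State n Var Val → Prop
  | nil (σ : State n Var Val) : StepSeq σ [] σ
  | cons {σ σ₁ σ₂ : State n Var Val} {b : Agent n} {e : Event Var Val Op Inn}
      {l : List (Agent n × Event Var Val Op Inn)}
      (head : Step σ b e σ₁) (tail : StepSeq σ₁ l σ₂) : StepSeq σ ((b, e) :: l) σ₂

/-- The order in which the agents act within a round: first the processes, then the dispatchers. -/
def agentOrder (n : ℕ) : List (Agent n) :=
  (List.finRange n).map Agent.proc ++ (List.finRange n).map Agent.disp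

section Events

variable {n : ℕ} {Var Val Op Inn : Type*}

/-- The action of which an event of a process is an occurrence. (`prop` events belong to dispatchers,
which follow no protocol.) -/
def Event.action : Event Var Val Op Inn → Action Var Val Op Inn
  | .W x v _ => .write x v
  | .RfB x _ _ => .read x
  | .RfM x _ => .read x
  | .RMW x vexp vnew => .rmw x vexp vnew
  | .F => .fence
  | .ret o => .ret o
  | .inner a => .inner a
  | .prop _ _ _ => .null
  | .null => .null

/-- The record that an event of a process adds to the local state of that process. -/
def Event.records : Event Var Val Op Inn → List (Record Var Val Op Inn)
  | .W x v _ => [.write x v]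
  | .RfB x v _ => [.read x v]
  | .RfM x v => [.read x v]
  | .RMW x vexp vnew => [.rmw x vexp vnew]
  | .F => [.fence]
  | .ret o => [.ret o]
  | .inner a => [.inner a]
  | .prop _ _ _ => []
  | .null => []

/-- The event is a memory access of the variable `x`. -/
def Event.Accesses (e : Event Var Val Op Inn) (x : Var) : Prop :=
  (∃ v, e = .RfM x v) ∨ (∃ vexp vnew, e = .RMW x vexp vnew) ∨ (∃ v k, e = .prop x v k)

def Event.IsRfM (e : Event Var Val Op Inn) : Prop := ∃ x v, e = .RfM x v

def Event.IsProp (e : Event Var Val Op Inn) : Prop := ∃ x v k, e = .prop x v k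

/-- The event is a fence or a read-modify-write. -/
def Event.IsSync (e : Event Var Val Op Inn) : Prop :=
  e = .F ∨ ∃ x vexp vnew, e = .RMW x vexp vnew

/-- A write event or a read-from-buffer event with tag number `k`. -/
def Event.UsesBuffer (e : Event Var Val Op Inn) (k : ℕ) : Prop :=
  (∃ x v, e = .W x v k) ∨ (∃ x v, e = .RfB x v k)

/-- `e` at `b` is a propagation by the dispatcher of a process and `e'` at `c` is a read from memory
by that same process. -/
def OwnPropRead (b : Agent n) (e : Event Var Val Op Inn) (c : Agent n)
    (e' : Event Var Val Op Inn) : Prop :=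
  ∃ i, b = .disp i ∧ c = .proc i ∧ e.IsProp ∧ e'.IsRfM

/-- Conflicting memory accesses `e` at `b` and `e'` at `c`. -/
def Conflicting (b : Agent n) (e : Event Var Val Op Inn) (c : Agent n)
    (e' : Event Var Val Op Inn) : Prop :=
  ¬ (e.IsRfM ∧ e'.IsRfM) ∧ (∃ x, e.Accesses x ∧ e'.Accesses x) ∧
    ¬ (OwnPropRead b e c e' ∨ OwnPropRead c e' b e)

/-- Number of writes performed so far, read off the local state. -/
def LocalState.numWrites (ℓ : LocalState Var Val Op Inn) : ℕ :=
  ℓ.countP fun | .write _ _ => true | _ => false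

/-- Number of operations invoked so far, read off the local state. -/
def LocalState.numInvokes (ℓ : LocalState Var Val Op Inn) : ℕ :=
  ℓ.countP fun | .invoke _ => true | _ => false

end Events

/-- A protocol: for every process and every local state a nonempty set of possible actions. -/
structure Protocol (n : ℕ) (Var Val Op Inn : Type*) where
  act : Fin n → LocalState Var Val Op Inn → Set (Action Var Val Op Inn)
  nonempty : ∀ i ℓ, (act i ℓ).Nonempty

/-- A TSO run. The joint action that leads from time `t` to time `t + 1` (round `t + 1`) is given by
the event `ev t b` of each agent `b`, i.e. what `b` does at node `⟨b, t⟩`, and by the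
invocations `inv t i` that the environment issues in that round. -/
structure Run (n : ℕ) (Var Val Op Inn : Type*) [DecidableEq Var] where
  tso : ℕ → State n Var Val
  loc : ℕ → Fin n → LocalState Var Val Op Inn
  ev : ℕ → Agent n → Event Var Val Op Inn
  inv : ℕ → Fin n → Option Op
  buf_zero : ∀ i, (tso 0).buf i = []
  loc_zero : ∀ i, loc 0 i = []
  /-- Every action of a joint action is enabled at the current state. -/
  enabled : ∀ t b, ∃ σ, Step (tso t) b (ev t b) σ
  /-- Joint actions contain no conflicting memory accesses. -/
  nonconflicting : ∀ t b c, b ≠ c → ¬ Conflicting b (ev t b) c (ev t c)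
  /-- An item is not propagated in the same round in which its owner reads it from the buffer. -/
  read_not_propagated : ∀ t i x v k y w,
    ev t (.proc i) = .RfB x v k → ev t (.disp i) ≠ .prop y w k
  /-- The `k`-th write of a process has tag number `k`. -/
  tag_write : ∀ t i x v k, ev t (.proc i) = .W x v k → k = (loc t i).numWrites
  tso_succ : ∀ t, StepSeq (tso t) ((agentOrder n).map fun b => (b, ev t b)) (tso (t + 1))
  loc_succ : ∀ t i, loc (t + 1) i =
    loc t i ++ (ev t (.proc i)).records ++ ((inv t i).map Record.invoke).toList
  /-- No operation is invoked at a process before the preceding one has returned. (Within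
  a round, the action of the process comes before the invocation.) -/
  inv_alternate : ∀ i t₁ t₂ o o₂, t₁ < t₂ → inv t₁ i = some o → inv t₂ i = some o₂ →
    ∃ u, t₁ < u ∧ u ≤ t₂ ∧ ev u (.proc i) = .ret o

namespace Run

variable {n : ℕ} {Var Val Op Inn : Type*} [DecidableEq Var]

/-- `r` is a run of the protocol `P`. -/
def IsRunOf (r : Run n Var Val Op Inn) (P : Protocol n Var Val Op Inn) : Prop :=
  ∀ t i, r.ev t (.proc i) ≠ .null → (r.ev t (.proc i)).action ∈ P.act i (r.loc t i)

/-- Local equivalence of runs: every process passes through the same local states. -/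
def LocallyEquiv (r r' : Run n Var Val Op Inn) : Prop :=
  ∀ j ℓ, (∃ t, r.loc t j = ℓ) ↔ (∃ t, r'.loc t j = ℓ)

/-- The occurs-before relation between nodes `⟨b, t⟩` of a run. -/
inductive OccursBefore (r : Run n Var Val Op Inn) : Agent n × ℕ → Agent n × ℕ → Prop
  | locality (b : Agent n) (t t' : ℕ) (h : t < t') : OccursBefore r (b, t) (b, t')
  | buffer (i : Fin n) (t t' : ℕ) (h : t < t') (k : ℕ)
      (huse : (r.ev t (.proc i)).UsesBuffer k)
      (hprop : ∃ x v, r.ev t' (.disp i) = .prop x v k) :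
      OccursBefore r (.proc i, t) (.disp i, t')
  | memory (b c : Agent n) (t t' : ℕ) (h : t < t') (x : Var)
      (hb : (r.ev t b).Accesses x) (hc : (r.ev t' c).Accesses x)
      (hreads : ¬ ((r.ev t b).IsRfM ∧ (r.ev t' c).IsRfM))
      (hown : ¬ OwnPropRead b (r.ev t b) c (r.ev t' c)) :
      OccursBefore r (b, t) (c, t')
  | sync (i : Fin n) (t t' : ℕ) (h : t < t')
      (hprop : (r.ev t (.disp i)).IsProp) (hsync : (r.ev t' (.proc i)).IsSync) :
      OccursBefore r (.disp i, t) (.proc i, t')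
  | trans (θ θ₁ θ₂ : Agent n × ℕ) (h₁ : OccursBefore r θ θ₁) (h₂ : OccursBefore r θ₁ θ₂) :
      OccursBefore r θ θ₂

/-- There is a feedback loop between the nodes `⟨i, t₁⟩` and `⟨i, t₂⟩`. -/
def FeedbackLoop (r : Run n Var Val Op Inn) (i : Fin n) (t₁ t₂ : ℕ) : Prop :=
  ∃ (b : Agent n) (t : ℕ), b ≠ .proc i ∧ b ≠ .disp i ∧
    r.OccursBefore (.proc i, t₁) (b, t) ∧ r.OccursBefore (b, t) (.proc i, t₂)

/-- The `m`-th operation of process `i` (counted from `0`) is an operation `o` that occurs between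
the nodes `⟨i, s⟩` and `⟨i, e⟩`: it is invoked in round `s + 1`, and its matching return,
the first `ret o` after the invocation, is performed in round `e`, i.e. at node `⟨i, e - 1⟩`. -/
def OpOccurs (r : Run n Var Val Op Inn) (i : Fin n) (m : ℕ) (o : Op) (s e : ℕ) : Prop :=
  r.inv s i = some o ∧ (r.loc s i).numInvokes = m ∧
    ∃ u, e = u + 1 ∧ s < u ∧ r.ev u (.proc i) = .ret o ∧
      ∀ w, s < w → w < u → r.ev w (.proc i) ≠ .ret o

/-- Process `i` writes the tag `⟨i, k⟩` at time `t`. -/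
def WritesTag (r : Run n Var Val Op Inn) (i : Fin n) (k t : ℕ) : Prop :=
  ∃ x v, r.ev t (.proc i) = .W x v k

/-- The tag `⟨i, k⟩` is propagated to memory at time `t`. -/
def PropagatesTag (r : Run n Var Val Op Inn) (i : Fin n) (k t : ℕ) : Prop :=
  ∃ x v, r.ev t (.disp i) = .prop x v k

/-- The action `a` of process `i` is enabled at time `t`. -/
def ActionEnabled (r : Run n Var Val Op Inn) (t : ℕ) (i : Fin n)
    (a : Action Var Val Op Inn) : Prop :=
  ∃ (e : Event Var Val Op Inn) (σ : State n Var Val), e.action = a ∧ Step (r.tso t) (.proc i) e σ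

/-- Fairness: a dispatcher with a nonempty buffer eventually propagates, and a process that
from some time on always has an enabled non-null action according to its protocol
eventually moves. -/
def Fair (r : Run n Var Val Op Inn) (P : Protocol n Var Val Op Inn) : Prop :=
  (∀ i t, (r.tso t).buf i ≠ [] → ∃ t', t ≤ t' ∧ (r.ev t' (.disp i)).IsProp) ∧
    ∀ i t, (∀ t', t ≤ t' → ∃ a ∈ P.act i (r.loc t' i), a ≠ .null ∧ r.ActionEnabled t' i a) →
      ∃ t', t ≤ t' ∧ r.ev t' (.proc i) ≠ .null

end Run

end TSO

/-! The new run is obtained by cutting `r` along occurs-before. Let `p` be the time at which κ is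
propagated, and let `D` consist of the node `⟨d_i, p⟩` and all nodes that it occurs before. The
nodes before time `e` outside `D` keep their times; all other nodes are performed with delay `e`. If
κ is never propagated, `r` itself will do.

Process `i` is not held up before `e`. The write of κ places `⟨d_i, p⟩` after `X.s`. A chain from
there back to `i` before `X.e` either visits a third agent, which makes a feedback loop, or passes
directly from `d_i` to `i`, which takes a fence or an RMW (`not_occursBefore_of_not_feedbackLoop`).

The main work is to show that performing the events of `r` along any increasing sequence of
down-closed cuts gives a run. The state after a cut is determined by the cut: a buffer by the writes
and propagations of its owner, the memory at `x` by the stores to `x`. `IsCutState.round` maintains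
this description, and `cutEvent_enabled` derives from it that every event is still enabled. The one
dependency that occurs-before omits is that of a memory read by `j` on an earlier propagation by
`d_j`. If that propagation is postponed, the read finds the item still in the buffer and becomes an
`RfB`. It returns the same value (`mem_eq_of_cutBuf_eq`), and local states do not record the source
of a read, so the process sees no difference.

From time `2e` on, the new run is `r` shifted by `e`, hence fairness carries over. -/

namespace TSO

/-! ### Rounds as functions on TSO states. -/

section Effects

variable {n : ℕ} {Var Val Op Inn : Type*}

/-- The items that an event of a process appends to its buffer. -/
def Event.items : Event Var Val Op Inn → List (Item Var Val)
  | .W x v k => [⟨x, v, k⟩]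
  | _ => []

/-- The number of items that an event of a dispatcher removes from the buffer. -/
def Event.numProps : Event Var Val Op Inn → ℕ
  | .prop _ _ _ => 1
  | _ => 0

/-- The variable and the value that an event stores in the memory. -/
def Event.memWrite : Event Var Val Op Inn → Option (Var × Val)
  | .RMW x _ v => some (x, v)
  | .prop x v _ => some (x, v)
  | _ => none

theorem Event.accesses_of_memWrite {e : Event Var Val Op Inn} {x : Var} {v : Val}
    (h : e.memWrite = some (x, v)) : e.Accesses x := by
  cases e <;> simp_all [Event.memWrite, Event.Accesses]

theorem Event.not_isRfM_of_memWrite {e : Event Var Val Op Inn} {x : Var} {v : Val}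
    (h : e.memWrite = some (x, v)) : ¬ e.IsRfM := by
  cases e <;> simp_all [Event.memWrite, Event.IsRfM]

theorem State.ext' {σ τ : State n Var Val} (hm : ∀ x, σ.mem x = τ.mem x)
    (hb : ∀ j, σ.buf j = τ.buf j) : σ = τ := by
  cases σ; cases τ
  simp only [State.mk.injEq]
  exact ⟨funext hm, funext hb⟩

variable [DecidableEq Var]

/-- The effect of an event on the TSO state, disregarding whether it is enabled. -/
def State.apply (σ : State n Var Val) (a : Agent n × Event Var Val Op Inn) : State n Var Val where
  mem := match a.2.memWrite with
    | some (x, v) => Function.update σ.mem x v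
    | none => σ.mem
  buf j := if a.1 = .proc j then σ.buf j ++ a.2.items
    else if a.1 = .disp j then (σ.buf j).drop a.2.numProps else σ.buf j

theorem State.apply_mem_of_forall {a : Agent n × Event Var Val Op Inn} {x : Var}
    (h : ∀ v, a.2.memWrite ≠ some (x, v)) (σ : State n Var Val) : (σ.apply a).mem x = σ.mem x := by
  rcases hm : a.2.memWrite with _ | ⟨y, v⟩
  · simp [State.apply, hm]
  · have hxy : x ≠ y := by
      rintro rfl
      exact h v hm
    simp [State.apply, hm, hxy]

theorem Step.eq_apply {σ τ : State n Var Val} {b : Agent n} {e : Event Var Val Op Inn}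
    (h : Step σ b e τ) : τ = σ.apply (b, e) := by
  cases h <;> refine State.ext' (fun x => ?_) (fun j => ?_) <;>
    simp [State.apply, Event.memWrite, Event.items, Event.numProps, Function.update_apply]
  case write.refine_2 i x v k =>
    by_cases hj : j = i
    · subst hj; simp
    · simp [hj, Ne.symm hj]
  case propagate.refine_2 i x v k β hbuf =>
    by_cases hj : j = i
    · subst hj; simp [hbuf]
    · simp [hj, Ne.symm hj]
theorem StepSeq.eq_foldl {σ τ : State n Var Val} {l : List (Agent n × Event Var Val Op Inn)}
    (h : StepSeq σ l τ) : τ = l.foldl State.apply σ := by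
  induction h with
  | nil => rfl
  | cons head _ ih => rw [ih, head.eq_apply]; rfl

theorem foldl_procs_buf (ev : Agent n → Event Var Val Op Inn) (j : Fin n) (L : List (Fin n))
    (hL : L.Nodup) (σ : State n Var Val) :
    (((L.map Agent.proc).map fun b => (b, ev b)).foldl State.apply σ).buf j =
      if j ∈ L then σ.buf j ++ (ev (.proc j)).items else σ.buf j := by
  induction L generalizing σ with
  | nil => simp
  | cons a L ih =>
    rw [List.nodup_cons] at hL
    simp only [List.map_cons, List.foldl_cons]
    rw [ih hL.2]
    by_cases ha : a = j
    · subst ha; simp [hL.1, State.apply]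
    · simp [State.apply, ha, Ne.symm ha]

theorem foldl_disps_buf (ev : Agent n → Event Var Val Op Inn) (j : Fin n) (L : List (Fin n))
    (hL : L.Nodup) (σ : State n Var Val) :
    (((L.map Agent.disp).map fun b => (b, ev b)).foldl State.apply σ).buf j =
      if j ∈ L then (σ.buf j).drop (ev (.disp j)).numProps else σ.buf j := by
  induction L generalizing σ with
  | nil => simp
  | cons a L ih =>
    rw [List.nodup_cons] at hL
    simp only [List.map_cons, List.foldl_cons]
    rw [ih hL.2]
    by_cases ha : a = j
    · subst ha; simp [hL.1, State.apply]
    · simp [State.apply, ha, Ne.symm ha]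

/-- The TSO state after a round in which each agent `b` performs `ev b`. -/
def State.round (σ : State n Var Val) (ev : Agent n → Event Var Val Op Inn) : State n Var Val :=
  ((agentOrder n).map fun b => (b, ev b)).foldl State.apply σ

theorem State.round_buf (σ : State n Var Val) (ev : Agent n → Event Var Val Op Inn) (j : Fin n) :
    (σ.round ev).buf j =
      (σ.buf j ++ (ev (.proc j)).items).drop (ev (.disp j)).numProps := by
  unfold State.round agentOrder
  rw [List.map_append, List.foldl_append, foldl_disps_buf _ _ _ (List.nodup_finRange n),
    foldl_procs_buf _ _ _ (List.nodup_finRange n)]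
  simp

theorem mem_agentOrder (b : Agent n) : b ∈ agentOrder n := by
  cases b <;> simp [agentOrder]

theorem foldl_mem_of_forall (ev : Agent n → Event Var Val Op Inn) (x : Var)
    (l : List (Agent n)) (h : ∀ b ∈ l, ∀ v, (ev b).memWrite ≠ some (x, v)) (σ : State n Var Val) :
    ((l.map fun b => (b, ev b)).foldl State.apply σ).mem x = σ.mem x := by
  induction l generalizing σ with
  | nil => rfl
  | cons a l ih =>
    simp only [List.map_cons, List.foldl_cons]
    rw [ih (fun b hb => h b (List.mem_cons_of_mem _ hb))]
    exact State.apply_mem_of_forall (h a List.mem_cons_self) σ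

theorem State.round_mem_of_forall {ev : Agent n → Event Var Val Op Inn} {x : Var}
    (h : ∀ b v, (ev b).memWrite ≠ some (x, v)) (σ : State n Var Val) :
    (σ.round ev).mem x = σ.mem x :=
  foldl_mem_of_forall ev x _ (fun b _ => h b) σ

/-- Processes act before dispatchers, so no process finds its buffer shortened by its own dispatcher
within a round, and the own-propagation exemption from conflicts does no harm. -/
theorem agentOrder_pairwise :
    (agentOrder n).Pairwise fun a b => a ≠ b ∧ ∀ j, ¬ (a = .disp j ∧ b = .proc j) := by
  unfold agentOrder
  refine List.pairwise_append.2 ⟨?_, ?_, ?_⟩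
  · refine List.pairwise_map.2 ((List.nodup_finRange n).imp fun {a b} hab => ⟨?_, ?_⟩) <;> simp_all
  · refine List.pairwise_map.2 ((List.nodup_finRange n).imp fun {a b} hab => ⟨?_, ?_⟩) <;> simp_all
  · simp

theorem State.round_mem_of_memWrite {ev : Agent n → Event Var Val Op Inn} {x : Var} {v : Val}
    {b : Agent n} (hb : (ev b).memWrite = some (x, v))
    (h : ∀ c v', c ≠ b → (ev c).memWrite ≠ some (x, v')) (σ : State n Var Val) :
    (σ.round ev).mem x = v := by
  obtain ⟨l₁, l₂, hl⟩ := List.append_of_mem (mem_agentOrder b)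
  have hnd : (l₁ ++ b :: l₂).Nodup := hl ▸ (agentOrder_pairwise (n := n)).imp fun h => h.1
  have hb₂ : b ∉ l₂ := (List.nodup_cons.1 (List.nodup_append.1 hnd).2.1).1
  unfold State.round
  rw [hl, List.map_append, List.foldl_append, List.map_cons, List.foldl_cons,
    foldl_mem_of_forall ev x l₂ (fun c hc v' => h c v' (fun hcb => hb₂ (hcb ▸ hc)))]
  simp [State.apply, hb]

/-- An enabled event stays enabled when another agent acts before it without a conflict. -/
theorem Step.enabled_apply {σ σ' : State n Var Val} {a b : Agent n}
    {f e : Event Var Val Op Inn} (h : Step σ b e σ') (hab : a ≠ b)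
    (hord : ∀ j, ¬ (a = .disp j ∧ b = .proc j)) (hc : ¬ Conflicting a f b e) :
    ∃ τ, Step (σ.apply (a, f)) b e τ := by
  have hbuf : ∀ i, b = .proc i → (σ.apply (a, f)).buf i = σ.buf i := by
    rintro i rfl
    have := hord i
    simp_all [State.apply]
  have hmem : ∀ i x, b = .proc i → e.Accesses x → (σ.apply (a, f)).mem x = σ.mem x := by
    rintro i x rfl hx
    -- A store by `a` to the accessed variable would be a conflict: the only exemption, a
    -- propagation before the owner's read, is ruled out by the order of the agents.
    have key : ∀ v, f.memWrite ≠ some (x, v) := fun v hv => hc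
      ⟨fun hh => Event.not_isRfM_of_memWrite hv hh.1,
        ⟨x, Event.accesses_of_memWrite hv, hx⟩, by
          rintro (⟨j, h1, h2, -⟩ | ⟨j, h1, -⟩)
          · exact hord j ⟨h1, h2⟩
          · cases h1⟩
    exact State.apply_mem_of_forall key σ
  cases h with
  | write i x v k => exact ⟨_, .write _ _ _ _ _⟩
  | readBuf i x v k β₁ β₂ hb hl =>
    exact ⟨_, .readBuf _ _ _ _ _ β₁ β₂ ((hbuf i rfl).trans hb) hl⟩
  | readMem i x hb =>
    rw [← hmem i x rfl (Or.inl ⟨_, rfl⟩)]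
    exact ⟨_, .readMem _ _ _ (by rwa [hbuf i rfl])⟩
  | rmw i x vexp vnew hb hm =>
    exact ⟨_, .rmw _ _ _ _ _ ((hbuf i rfl).trans hb)
      ((hmem i x rfl (Or.inr (Or.inl ⟨_, _, rfl⟩))).trans hm)⟩
  | fence i hb => exact ⟨_, .fence _ _ ((hbuf i rfl).trans hb)⟩
  | propagate i x v k β hb =>
    -- If the owner writes earlier in the round, the new item is appended at the back and leaves the
    -- head in place.
    refine ⟨_, .propagate _ _ _ _ _ (if a = .proc i then β ++ f.items else β) ?_⟩
    simp only [State.apply, hab, if_false, hb]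
    split <;> simp
  | ret i o => exact ⟨_, .ret _ _ _⟩
  | inner i a => exact ⟨_, .inner _ _ _⟩
  | null => exact ⟨_, .null _ _⟩

theorem stepSeq_foldl {ev : Agent n → Event Var Val Op Inn}
    (hc : ∀ a b, a ≠ b → ¬ Conflicting a (ev a) b (ev b)) (l : List (Agent n))
    (hl : l.Pairwise fun a b => a ≠ b ∧ ∀ j, ¬ (a = .disp j ∧ b = .proc j))
    (σ : State n Var Val) (he : ∀ b ∈ l, ∃ τ, Step σ b (ev b) τ) :
    StepSeq σ (l.map fun b => (b, ev b)) ((l.map fun b => (b, ev b)).foldl State.apply σ) := by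
  induction l generalizing σ with
  | nil => exact .nil σ
  | cons a l ih =>
    rw [List.pairwise_cons] at hl
    obtain ⟨τ, hτ⟩ := he a List.mem_cons_self
    rw [hτ.eq_apply] at hτ
    refine .cons hτ (ih hl.2 _ fun b hb => ?_)
    obtain ⟨τ', hτ'⟩ := he b (List.mem_cons_of_mem _ hb)
    exact hτ'.enabled_apply (hl.1 b hb).1 (hl.1 b hb).2 (hc a b (hl.1 b hb).1)

/-- Enabled events without conflicts can be performed one by one. -/
theorem State.stepSeq_round {ev : Agent n → Event Var Val Op Inn}
    (hc : ∀ a b, a ≠ b → ¬ Conflicting a (ev a) b (ev b)) (σ : State n Var Val)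
    (he : ∀ b, ∃ τ, Step σ b (ev b) τ) :
    StepSeq σ ((agentOrder n).map fun b => (b, ev b)) (σ.round ev) :=
  stepSeq_foldl hc _ agentOrder_pairwise σ fun b _ => he b

end Effects

/-! ### Buffers and memory of a run in terms of its history. -/

namespace Run

variable {n : ℕ} {Var Val Op Inn : Type*} [DecidableEq Var] (r : Run n Var Val Op Inn)

/-- The items written by process `j` before time `t`. -/
def writes (j : Fin n) : ℕ → List (Item Var Val)
  | 0 => []
  | t + 1 => writes j t ++ (r.ev t (.proc j)).items

/-- The number of items propagated by the dispatcher of process `j` before time `t`. -/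
def props (j : Fin n) : ℕ → ℕ
  | 0 => 0
  | t + 1 => props j t + (r.ev t (.disp j)).numProps

theorem tso_succ_eq (t : ℕ) : r.tso (t + 1) = (r.tso t).round (r.ev t) :=
  (r.tso_succ t).eq_foldl

/-- The two claims need a joint induction: appending commutes with dropping only under the bound,
and the bound persists because a propagation needs a nonempty buffer. -/
theorem buf_eq_and_props_le (j : Fin n) (t : ℕ) :
    (r.tso t).buf j = (r.writes j t).drop (r.props j t) ∧
      r.props j t ≤ (r.writes j t).length := by
  induction t with
  | zero => simp [writes, props, r.buf_zero]
  | succ t ih =>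
    obtain ⟨hb, hl⟩ := ih
    constructor
    · rw [tso_succ_eq, State.round_buf, hb, ← List.drop_append_of_le_length hl, List.drop_drop]
      rfl
    · obtain ⟨τ, hτ⟩ := r.enabled t (.disp j)
      simp only [writes, props, List.length_append]
      generalize r.ev t (.disp j) = e at *
      cases hτ with
      | propagate _ x v k β hbuf =>
        rw [hb] at hbuf
        have := congrArg List.length hbuf
        simp at this
        simp only [Event.numProps]
        omega
      | null => simp only [Event.numProps]; omega

theorem buf_eq (j : Fin n) (t : ℕ) : (r.tso t).buf j = (r.writes j t).drop (r.props j t) :=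
  (r.buf_eq_and_props_le j t).1

theorem props_le (j : Fin n) (t : ℕ) : r.props j t ≤ (r.writes j t).length :=
  (r.buf_eq_and_props_le j t).2

theorem props_mono (j : Fin n) : Monotone (r.props j) :=
  monotone_nat_of_le_succ fun _ => Nat.le_add_right _ _

theorem writes_prefix (j : Fin n) {t t' : ℕ} (h : t ≤ t') : r.writes j t <+: r.writes j t' := by
  induction h with
  | refl => exact List.prefix_rfl
  | step _ ih => exact ih.trans (List.prefix_append _ _)

theorem writes_getElem?_mono (j : Fin n) {t t' p : ℕ} {c : Item Var Val} (h : t ≤ t')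
    (hc : (r.writes j t)[p]? = some c) : (r.writes j t')[p]? = some c := by
  obtain ⟨l, hl⟩ := r.writes_prefix j h
  rw [← hl, List.getElem?_append_left (List.getElem?_eq_some_iff.1 hc).1, hc]

theorem length_writes (j : Fin n) (t : ℕ) :
    (r.writes j t).length = (r.loc t j).numWrites := by
  induction t with
  | zero => simp [writes, r.loc_zero, LocalState.numWrites]
  | succ t ih =>
    rw [r.loc_succ]
    simp only [writes, List.length_append, ih, LocalState.numWrites, List.countP_append]
    cases r.inv t j <;> cases r.ev t (.proc j) <;> simp [Event.items, Event.records]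

theorem tag_eq_length {j : Fin n} {t k : ℕ} {x : Var} {v : Val}
    (h : r.ev t (.proc j) = .W x v k) : k = (r.writes j t).length := by
  rw [length_writes]; exact r.tag_write t j x v k h

/-- Tags count writes from `0`, so the tag of an item is its position in the history of writes.
Questions about tags thus become questions about list indices. -/
theorem writes_getElem? {j : Fin n} {t p : ℕ} {c : Item Var Val}
    (h : (r.writes j t)[p]? = some c) :
    c.tag = p ∧ ∃ w < t, r.ev w (.proc j) = .W c.var c.val p := by
  induction t with
  | zero => simp [writes] at h
  | succ t ih =>
    by_cases hp : p < (r.writes j t).length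
    · rw [writes, List.getElem?_append_left hp] at h
      obtain ⟨h1, w, hw, h2⟩ := ih h
      exact ⟨h1, w, hw.trans (Nat.lt_succ_self t), h2⟩
    · push Not at hp
      rw [writes, List.getElem?_append_right hp] at h
      cases he : r.ev t (.proc j) <;> rw [he] at h <;> simp [Event.items] at h
      rename_i x v k
      rw [List.getElem?_singleton] at h
      split at h
      · rename_i hz
        have hk := r.tag_eq_length he
        cases h
        have hkp : k = p := by omega
        exact ⟨hkp, t, Nat.lt_succ_self t, by rw [he, hkp]⟩
      · cases h

theorem lt_length_of_write {j : Fin n} {t w k : ℕ} {x : Var} {v : Val}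
    (h : r.ev w (.proc j) = .W x v k) (hw : w < t) : k < (r.writes j t).length := by
  have h1 := r.tag_eq_length h
  have h2 := (r.writes_prefix j (Nat.succ_le_of_lt hw)).length_le
  simp [writes, h, Event.items] at h2
  omega

/-- By the FIFO discipline the head of the buffer sits in the history at the position given by the
number of earlier propagations. -/
theorem props_eq_of_prop {j : Fin n} {t k : ℕ} {x : Var} {v : Val}
    (h : r.ev t (.disp j) = .prop x v k) :
    r.props j t = k ∧ (r.writes j t)[k]? = some ⟨x, v, k⟩ := by
  obtain ⟨τ, hτ⟩ := r.enabled t (.disp j)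
  rw [h] at hτ
  cases hτ with
  | propagate _ _ _ _ β hbuf =>
    rw [buf_eq] at hbuf
    have h0 := congrArg (fun l => l[0]?) hbuf
    simp only [List.getElem?_drop, Nat.add_zero, List.getElem?_cons_zero] at h0
    have hk : k = r.props j t := (r.writes_getElem? h0).1
    rw [← hk] at h0
    exact ⟨hk.symm, h0⟩

theorem props_succ_of_prop {j : Fin n} {t k : ℕ} {x : Var} {v : Val}
    (h : r.ev t (.disp j) = .prop x v k) : r.props j (t + 1) = k + 1 := by
  simp [props, (r.props_eq_of_prop h).1, h, Event.numProps]

theorem exists_prop_of_lt {j : Fin n} {t p : ℕ} (h : p < r.props j t) :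
    ∃ t' < t, ∃ x v, r.ev t' (.disp j) = .prop x v p := by
  induction t with
  | zero => simp [props] at h
  | succ t ih =>
    by_cases hp : p < r.props j t
    · obtain ⟨t', ht', h'⟩ := ih hp
      exact ⟨t', ht'.trans (Nat.lt_succ_self t), h'⟩
    · refine ⟨t, Nat.lt_succ_self t, ?_⟩
      cases he : r.ev t (.disp j) <;> simp [props, he, Event.numProps] at h <;>
        first | exact absurd h hp | skip
      rename_i x v k
      have := (r.props_eq_of_prop he).1
      have hk : k = p := by omega
      exact ⟨x, v, by rw [hk]⟩

/-- The item propagated was written before. -/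
theorem exists_write_of_prop {j : Fin n} {t k : ℕ} {x : Var} {v : Val}
    (h : r.ev t (.disp j) = .prop x v k) : ∃ w < t, r.ev w (.proc j) = .W x v k :=
  (r.writes_getElem? (r.props_eq_of_prop h).2).2

/-- Two stores to one variable in the same round would conflict; the exemptions all involve a memory
read. -/
theorem memWrite_eq_of_eq_time {b c : Agent n} {t : ℕ} {x : Var} {v v' : Val}
    (hb : (r.ev t b).memWrite = some (x, v)) (hc : (r.ev t c).memWrite = some (x, v')) :
    b = c := by
  by_contra hne
  refine r.nonconflicting t b c hne ⟨fun h => Event.not_isRfM_of_memWrite hb h.1,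
    ⟨x, Event.accesses_of_memWrite hb, Event.accesses_of_memWrite hc⟩, ?_⟩
  rintro (⟨_, _, _, _, h⟩ | ⟨_, _, _, _, h⟩)
  · exact Event.not_isRfM_of_memWrite hc h
  · exact Event.not_isRfM_of_memWrite hb h

theorem mem_succ_of_memWrite {b : Agent n} {t : ℕ} {x : Var} {v : Val}
    (hb : (r.ev t b).memWrite = some (x, v)) : (r.tso (t + 1)).mem x = v := by
  rw [tso_succ_eq]
  exact State.round_mem_of_memWrite hb
    (fun c v' hc h => hc (r.memWrite_eq_of_eq_time h hb)) _

theorem mem_eq_of_forall {t t' : ℕ} {x : Var} (htt' : t ≤ t')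
    (h : ∀ u b v, t ≤ u → u < t' → (r.ev u b).memWrite ≠ some (x, v)) :
    (r.tso t').mem x = (r.tso t).mem x := by
  induction htt' with
  | refl => rfl
  | @step m hm ih =>
    rw [tso_succ_eq, State.round_mem_of_forall (fun b v => h m b v hm (Nat.lt_succ_self m)),
      ih fun u b v h1 h2 => h u b v h1 (h2.trans (Nat.lt_succ_self m))]

theorem OccursBefore.time_lt {r : Run n Var Val Op Inn} {θ θ' : Agent n × ℕ}
    (h : r.OccursBefore θ θ') : θ.2 < θ'.2 := by
  induction h with
  | trans _ _ _ _ _ ih₁ ih₂ => exact ih₁.trans ih₂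
  | _ => assumption

end Run
end TSO

namespace TSO

/-! ### Redirecting memory reads to the buffer. -/

section Resolve

variable {n : ℕ} {Var Val Op Inn : Type*} [DecidableEq Var]

/-- A read is redirected to the latest matching item of the buffer `β`, if there is one. -/
def Event.resolve (β : List (Item Var Val)) : Event Var Val Op Inn → Event Var Val Op Inn
  | .RfM x v => match β.reverse.find? (fun c => c.var = x) with
    | some c => .RfB x v c.tag
    | none => .RfM x v
  | e => e

theorem Event.resolve_cases (β : List (Item Var Val)) (e : Event Var Val Op Inn) :
    e.resolve β = e ∨ ∃ x v, ∃ c ∈ β, c.var = x ∧ e = .RfM x v ∧ e.resolve β = .RfB x v c.tag := by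
  cases e <;> try exact Or.inl rfl
  rename_i x v
  rcases h : β.reverse.find? (fun c => c.var = x) with _ | c
  · left; simp only [Event.resolve, h]
  · right
    refine ⟨x, v, c, List.mem_reverse.1 (List.mem_of_find?_eq_some h), ?_, rfl, ?_⟩
    · simpa using List.find?_some h
    · simp only [Event.resolve, h]

theorem Event.resolve_action (β : List (Item Var Val)) (e : Event Var Val Op Inn) :
    (e.resolve β).action = e.action := by
  rcases e.resolve_cases β with h | ⟨x, v, c, -, -, h, h'⟩
  · rw [h]
  · rw [h', h]; rfl

theorem Event.resolve_records (β : List (Item Var Val)) (e : Event Var Val Op Inn) :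
    (e.resolve β).records = e.records := by
  rcases e.resolve_cases β with h | ⟨x, v, c, -, -, h, h'⟩
  · rw [h]
  · rw [h', h]; rfl

theorem Event.resolve_items (β : List (Item Var Val)) (e : Event Var Val Op Inn) :
    (e.resolve β).items = e.items := by
  rcases e.resolve_cases β with h | ⟨x, v, c, -, -, h, h'⟩
  · rw [h]
  · rw [h', h]; rfl

theorem Event.resolve_memWrite (β : List (Item Var Val)) (e : Event Var Val Op Inn) :
    (e.resolve β).memWrite = e.memWrite := by
  rcases e.resolve_cases β with h | ⟨x, v, c, -, -, h, h'⟩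
  · rw [h]
  · rw [h', h]; rfl

theorem Event.resolve_eq_of_accesses {β : List (Item Var Val)} {e : Event Var Val Op Inn} {x : Var}
    (hx : (e.resolve β).Accesses x) : e.resolve β = e := by
  rcases e.resolve_cases β with h | ⟨y, v, c, -, -, h, h'⟩
  · exact h
  · rw [h'] at hx
    simp [Event.Accesses] at hx

end Resolve

/-! ### Down-closed cuts and the states they determine. -/

namespace Run

variable {n : ℕ} {Var Val Op Inn : Type*} [DecidableEq Var] (r : Run n Var Val Op Inn)

/-- A cut, which consists of the nodes `⟨b, t⟩` with `t < c b`, is closed under predecessors. -/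
def DownClosed (c : Agent n → ℕ) : Prop :=
  ∀ b t b' t', r.OccursBefore (b, t) (b', t') → t' < c b' → t < c b

/-- The buffer of process `j` after the events of the cut `c`. -/
def cutBuf (c : Agent n → ℕ) (j : Fin n) : List (Item Var Val) :=
  (r.writes j (c (.proc j))).drop (r.props j (c (.disp j)))

/-- The cut `c` contains the same stores to `x` as the cut of all nodes before time `T`. -/
def Separates (c : Agent n → ℕ) (x : Var) (T : ℕ) : Prop :=
  ∀ b t v, (r.ev t b).memWrite = some (x, v) → (t < T ↔ t < c b)

/-- `σ` is the TSO state that results from the events of the cut `c`. -/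
def IsCutState (c : Agent n → ℕ) (σ : State n Var Val) : Prop :=
  (∀ j, σ.buf j = r.cutBuf c j) ∧
    -- No single `T` fits all variables. For one `x`, occurs-before orders the stores linearly, so a
    -- down-closed cut contains an initial segment of them.
    ∀ x T, r.Separates c x T → σ.mem x = (r.tso T).mem x

/-- The cut `c'` extends the cut `c` by nodes of time `t`. -/
def CutStep (c c' : Agent n → ℕ) (t : ℕ) : Prop :=
  ∀ b, c' b = c b ∨ (c b = t ∧ c' b = t + 1)

/-- The event of agent `b` in the round that extends the cut `c` to `c'`. -/
def cutEvent (c c' : Agent n → ℕ) (b : Agent n) : Event Var Val Op Inn :=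
  if c' b = c b + 1 then
    match b with
    | .proc j => (r.ev (c b) b).resolve (r.cutBuf c j)
    | .disp _ => r.ev (c b) b
  else .null

section Cut

variable {r} {c c' : Agent n → ℕ} {t : ℕ}

theorem cutEvent_of_eq {b : Agent n} (h : c' b = c b) : r.cutEvent c c' b = .null :=
  if_neg (by omega)

theorem cutEvent_proc {j : Fin n} (h : c' (.proc j) = c (.proc j) + 1) :
    r.cutEvent c c' (.proc j) = (r.ev (c (.proc j)) (.proc j)).resolve (r.cutBuf c j) :=
  if_pos h

theorem cutEvent_disp {j : Fin n} (h : c' (.disp j) = c (.disp j) + 1) :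
    r.cutEvent c c' (.disp j) = r.ev (c (.disp j)) (.disp j) :=
  if_pos h

/-- A redirected read no longer accesses memory. Hence the accesses in a new round all come
unchanged from round `t + 1` of `r`, and absence of conflicts is inherited. -/
theorem cutEvent_eq_of_accesses {b : Agent n} {x : Var} (hs : CutStep c c' t)
    (h : (r.cutEvent c c' b).Accesses x) : c b = t ∧ r.cutEvent c c' b = r.ev t b := by
  rcases hs b with hb | ⟨hb, hb'⟩
  · rw [cutEvent_of_eq hb] at h
    simp [Event.Accesses] at h
  · refine ⟨hb, ?_⟩
    cases b with
    | proc j =>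
      rw [cutEvent_proc (by omega)] at h ⊢
      rw [Event.resolve_eq_of_accesses h, hb]
    | disp j => rw [cutEvent_disp (by omega), hb]

theorem cutEvent_memWrite {b : Agent n} (h : c' b = c b + 1) :
    (r.cutEvent c c' b).memWrite = (r.ev (c b) b).memWrite := by
  cases b with
  | proc j => rw [cutEvent_proc h, Event.resolve_memWrite]
  | disp j => rw [cutEvent_disp h]

theorem cutEvent_action (j : Fin n) (h : c' (.proc j) = c (.proc j) + 1) :
    (r.cutEvent c c' (.proc j)).action = (r.ev (c (.proc j)) (.proc j)).action := by
  rw [cutEvent_proc h, Event.resolve_action]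

theorem cutEvent_nonconflicting (hs : CutStep c c' t) {a b : Agent n} (hab : a ≠ b) :
    ¬ Conflicting a (r.cutEvent c c' a) b (r.cutEvent c c' b) := by
  intro h
  obtain ⟨x, ha, hb⟩ := h.2.1
  rw [(cutEvent_eq_of_accesses hs ha).2, (cutEvent_eq_of_accesses hs hb).2] at h
  exact r.nonconflicting t a b hab h

theorem cutEvent_read_not_propagated (hs : CutStep c c' t) {j : Fin n} {x y : Var} {v w : Val}
    {k : ℕ} (h : r.cutEvent c c' (.proc j) = .RfB x v k) :
    r.cutEvent c c' (.disp j) ≠ .prop y w k := by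
  intro h'
  have hd : c (.disp j) = t ∧ c' (.disp j) = t + 1 := by
    rcases hs (.disp j) with hb | hb
    · rw [cutEvent_of_eq hb] at h'; cases h'
    · exact hb
  have hp : c (.proc j) = t ∧ c' (.proc j) = t + 1 := by
    rcases hs (.proc j) with hb | hb
    · rw [cutEvent_of_eq hb] at h; cases h
    · exact hb
  rw [cutEvent_disp (by omega), hd.1] at h'
  rw [cutEvent_proc (by omega), hp.1] at h
  rcases Event.resolve_cases (r.cutBuf c j) (r.ev t (.proc j)) with he | ⟨z, u, d, hd', hz, he, he'⟩
  · rw [he] at h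
    exact r.read_not_propagated t j x v k y w h h'
  -- Both agents stand at time `t`, so the buffer at the cut is the buffer of `r` at time `t`, and a
  -- read from memory in `r` cannot have been redirected.
  · obtain ⟨τ, hτ⟩ := r.enabled t (.proc j)
    rw [he] at hτ
    cases hτ with
    | readMem _ _ hbuf =>
      rw [buf_eq] at hbuf
      rw [cutBuf, hd.1, hp.1] at hd'
      exact hbuf d hd' hz

/-- All nodes added in one step have the same time, so none of them occurs before another;
predecessors lie in the old cut already. -/
theorem lt_of_occursBefore (hc' : r.DownClosed c') (hs : CutStep c c' t) {a b : Agent n} {u : ℕ}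
    (hb : c' b = t + 1) (h : r.OccursBefore (a, u) (b, t)) : u < c a := by
  have h1 := hc' _ _ _ _ h (by omega)
  have h2 : u < t := h.time_lt
  rcases hs a with h3 | h3 <;> omega

theorem not_occursBefore (hc : r.DownClosed c) {a b : Agent n} {u : ℕ}
    (hb : c b = t) (h : r.OccursBefore (b, t) (a, u)) : ¬ u < c a := fun h1 => by
  have := hc _ _ _ _ h h1
  omega

/-- A write occurs before the propagation of its item, so a down-closed cut never propagates more
than it has written. -/
theorem DownClosed.props_le (hc : r.DownClosed c) (j : Fin n) :
    r.props j (c (.disp j)) ≤ (r.writes j (c (.proc j))).length := by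
  by_contra hlt
  push Not at hlt
  obtain ⟨u, hu, x, v, he⟩ := r.exists_prop_of_lt hlt
  obtain ⟨w, hw, he'⟩ := r.exists_write_of_prop he
  have hwc := hc _ _ _ _ (.buffer j w u hw _ (Or.inl ⟨x, v, he'⟩) ⟨x, v, he⟩) hu
  exact lt_irrefl _ (r.lt_length_of_write he' hwc)

theorem cutBuf_step (hc : r.DownClosed c) (hs : CutStep c c' t) (j : Fin n) :
    r.cutBuf c' j = (r.cutBuf c j ++ (r.cutEvent c c' (.proc j)).items).drop
      (r.cutEvent c c' (.disp j)).numProps := by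
  have hw : r.writes j (c' (.proc j)) =
      r.writes j (c (.proc j)) ++ (r.cutEvent c c' (.proc j)).items := by
    rcases hs (.proc j) with h | h
    · rw [cutEvent_of_eq h, h]; simp [Event.items]
    · rw [cutEvent_proc (by omega), Event.resolve_items, h.1, h.2]; rfl
  have hp : r.props j (c' (.disp j)) =
      r.props j (c (.disp j)) + (r.cutEvent c c' (.disp j)).numProps := by
    rcases hs (.disp j) with h | h
    · rw [cutEvent_of_eq h, h]; simp [Event.numProps]
    · rw [cutEvent_disp (by omega), h.1, h.2]; rfl
  rw [cutBuf, cutBuf, hw, hp, ← List.drop_append_of_le_length (hc.props_le j), List.drop_drop]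

/-- At a node outside the cut that accesses `x`, the cut agrees with the past of the node on the
stores to `x`, provided it does on the propagations of the own dispatcher. -/
theorem separates_of_accesses (hc : r.DownClosed c) (hc' : r.DownClosed c') (hs : CutStep c c' t)
    {b : Agent n} (hb : c b = t) (hb' : c' b = t + 1) {x : Var} (hx : (r.ev t b).Accesses x)
    (hown : ∀ a u v, (r.ev u a).memWrite = some (x, v) →
      OwnPropRead a (r.ev u a) b (r.ev t b) → (u < t ↔ u < c a)) :
    r.Separates c x t := by
  intro a u v hw
  by_cases ho : OwnPropRead a (r.ev u a) b (r.ev t b)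
  · exact hown a u v hw ho
  by_cases hab : a = b
  · rw [hab, hb]
  have hrd := Event.not_isRfM_of_memWrite hw
  have hwx := Event.accesses_of_memWrite hw
  have ho' : ¬ OwnPropRead b (r.ev t b) a (r.ev u a) := fun ⟨_, _, _, _, h⟩ => hrd h
  rcases lt_trichotomy u t with h | h | h
  · exact iff_of_true h (lt_of_occursBefore hc' hs hb'
      (.memory a b u t h x hwx hx (fun h => hrd h.1) ho))
  · subst h
    -- Occurs-before says nothing about equal times; there the ban on conflicts within a round takes
    -- over.
    exact absurd ⟨fun h => hrd h.1, ⟨x, hwx, hx⟩, fun h => h.elim ho ho'⟩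
      (r.nonconflicting u a b hab)
  · exact iff_of_false h.le.not_gt (not_occursBefore hc hb
      (.memory b a t u h x hx hwx (fun h => hrd h.2) ho'))

theorem separates_of_memWrite (hc : r.DownClosed c) (hc' : r.DownClosed c') (hs : CutStep c c' t)
    {b : Agent n} (hb : c b = t) (hb' : c' b = t + 1) {x : Var} {v : Val}
    (hx : (r.ev t b).memWrite = some (x, v)) : r.Separates c' x (t + 1) := by
  have h0 := separates_of_accesses hc hc' hs hb hb' (Event.accesses_of_memWrite hx)
    fun _ _ _ _ ⟨_, _, _, _, h⟩ => absurd h (Event.not_isRfM_of_memWrite hx)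
  intro a u w hw
  have h1 := h0 a u w hw
  rcases eq_or_ne u t with h | h
  · subst h
    rw [r.memWrite_eq_of_eq_time hw hx, hb']
  · rcases hs a with h2 | h2 <;> omega

theorem separates_of_step (hs : CutStep c c' t) {x : Var} {T : ℕ}
    (hx : ∀ b v, c' b = c b + 1 → (r.ev (c b) b).memWrite ≠ some (x, v))
    (hT : r.Separates c' x T) : r.Separates c x T := by
  intro a u w hw
  rw [hT a u w hw]
  rcases hs a with h | h
  · rw [h]
  · have : u ≠ t := by
      rintro rfl
      exact hx a w (by omega) (by rw [h.1, hw])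
    omega

/-- If some added node stores to `x`, it is the latest store to `x` in both the new cut and the past
of time `t + 1`. If none does, both cuts contain the same stores to `x`. -/
theorem IsCutState.round {σ : State n Var Val} (hσ : r.IsCutState c σ) (hc : r.DownClosed c)
    (hc' : r.DownClosed c') (hs : CutStep c c' t) :
    r.IsCutState c' (σ.round (r.cutEvent c c')) := by
  refine ⟨fun j => ?_, fun x T hT => ?_⟩
  · rw [State.round_buf, hσ.1, ← cutBuf_step hc hs]
  · by_cases hx : ∃ b v, c' b = c b + 1 ∧ (r.ev (c b) b).memWrite = some (x, v)
    · obtain ⟨b, v, hb, hw⟩ := hx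
      have hbt : c b = t ∧ c' b = t + 1 := by
        rcases hs b with h | h
        · omega
        · exact h
      have hw' := hw
      rw [hbt.1] at hw'
      rw [State.round_mem_of_memWrite ((cutEvent_memWrite hb).trans hw), ← r.mem_succ_of_memWrite hw']
      · have hT' := separates_of_memWrite hc hc' hs hbt.1 hbt.2 hw'
        rcases le_total (t + 1) T with h | h
        · refine (r.mem_eq_of_forall h fun u a w h1 h2 h3 => ?_).symm
          have := hT a u w h3
          have := hT' a u w h3
          omega
        · refine r.mem_eq_of_forall h fun u a w h1 h2 h3 => ?_
          have := hT a u w h3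
          have := hT' a u w h3
          omega
      · intro a w hab h
        obtain ⟨-, h'⟩ := cutEvent_eq_of_accesses hs (Event.accesses_of_memWrite h)
        rw [h'] at h
        exact hab (r.memWrite_eq_of_eq_time h hw')
    · push Not at hx
      rw [State.round_mem_of_forall, hσ.2 x T (separates_of_step hs (fun b v => hx b v) hT)]
      intro b v h
      obtain ⟨h1, h2⟩ := cutEvent_eq_of_accesses hs (Event.accesses_of_memWrite h)
      rcases hs b with h3 | h3
      · rw [cutEvent_of_eq h3] at h; cases h
      · rw [h2] at h
        exact hx b v (by omega) (by rw [h1, h])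

/-- Everything `j` has written was propagated before `t`, and by the synchronization clause these
propagations belong to the cut. -/
theorem cutBuf_eq_nil (hc' : r.DownClosed c') (hs : CutStep c c' t) {j : Fin n}
    (hb : c (.proc j) = t) (hb' : c' (.proc j) = t + 1) (hsync : (r.ev t (.proc j)).IsSync)
    (hbuf : (r.tso t).buf j = []) : r.cutBuf c j = [] := by
  rw [buf_eq, List.drop_eq_nil_iff] at hbuf
  rw [cutBuf, List.drop_eq_nil_iff, hb]
  by_contra hlt
  push Not at hlt
  obtain ⟨u, hu, x, v, he⟩ := r.exists_prop_of_lt (hlt.trans_le hbuf)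
  have h1 := lt_of_occursBefore hc' hs hb' (.sync j u t hu ⟨x, v, _, he⟩ hsync)
  have h2 := r.props_mono j (Nat.succ_le_of_lt h1)
  rw [Nat.succ_eq_add_one, r.props_succ_of_prop he] at h2
  omega

/-- The writes of `j` are those before `t`, so only the front of the buffer can differ. The item
read is still there, because its read occurs before any later propagation and a propagation in the
same round is forbidden. -/
theorem cutBuf_readBuf (hc : r.DownClosed c) {j : Fin n} (hb : c (.proc j) = t)
    {x : Var} {v : Val} {k : ℕ} (he : r.ev t (.proc j) = .RfB x v k)
    {β₁ β₂ : List (Item Var Val)} (hbuf : (r.tso t).buf j = β₁ ++ ⟨x, v, k⟩ :: β₂) :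
    ∃ β, r.cutBuf c j = β ++ ⟨x, v, k⟩ :: β₂ := by
  rw [buf_eq] at hbuf
  obtain ⟨γ, hγ, hlen⟩ : ∃ γ, r.writes j t = γ ++ ⟨x, v, k⟩ :: β₂ ∧ r.props j t ≤ γ.length := by
    refine ⟨(r.writes j t).take (r.props j t) ++ β₁, ?_, ?_⟩
    · rw [List.append_assoc, ← hbuf, List.take_append_drop]
    · have := r.props_le j t
      simp
      omega
  have hk : k = γ.length := by
    have h1 : (r.writes j t)[γ.length]? = some ⟨x, v, k⟩ := by simp [hγ]
    exact (r.writes_getElem? h1).1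
  have hP : r.props j (c (.disp j)) ≤ γ.length := by
    by_contra hlt
    push Not at hlt
    rw [← hk] at hlt hlen
    obtain ⟨u, hu, y, w, he'⟩ := r.exists_prop_of_lt hlt
    rcases lt_trichotomy u t with h | h | h
    · have h2 := r.props_mono j (Nat.succ_le_of_lt h)
      rw [Nat.succ_eq_add_one, r.props_succ_of_prop he'] at h2
      omega
    · subst h
      exact r.read_not_propagated u j x v k y w he he'
    · exact not_occursBefore hc hb
        (.buffer j t u h k (Or.inr ⟨x, v, he⟩) ⟨y, w, he'⟩) hu
  exact ⟨γ.drop (r.props j (c (.disp j))), by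
    rw [cutBuf, hb, hγ, List.drop_append_of_le_length hP]⟩

theorem cutBuf_propagate (hc' : r.DownClosed c') (hs : CutStep c c' t) {j : Fin n}
    (hb : c (.disp j) = t) (hb' : c' (.disp j) = t + 1) {x : Var} {v : Val} {k : ℕ}
    (he : r.ev t (.disp j) = .prop x v k) : ∃ β, r.cutBuf c j = ⟨x, v, k⟩ :: β := by
  obtain ⟨hk, hget⟩ := r.props_eq_of_prop he
  obtain ⟨w, hw, hew⟩ := r.exists_write_of_prop he
  have hwc := lt_of_occursBefore hc' hs hb' (.buffer j w t hw k (Or.inl ⟨x, v, hew⟩) ⟨x, v, he⟩)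
  have hlt := r.lt_length_of_write hew hwc
  refine ⟨(r.writes j (c (.proc j))).drop (k + 1), ?_⟩
  rw [cutBuf, hb, hk, List.drop_eq_getElem_cons hlt]
  congr 1
  have h1 := List.getElem?_eq_getElem hlt
  rcases le_total t (c (.proc j)) with h | h
  · rw [r.writes_getElem?_mono j h hget] at h1
    exact (Option.some.inj h1).symm
  · rw [r.writes_getElem?_mono j h h1] at hget
    exact Option.some.inj hget

theorem mem_buf_of_getElem? {j : Fin n} {k : ℕ} {d : Item Var Val}
    (hd : (r.writes j t)[k]? = some d) {p : ℕ} (hk : p ≤ k) : d ∈ (r.writes j t).drop p := by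
  refine List.mem_of_getElem? (i := k - p) ?_
  rw [List.getElem?_drop, Nat.add_sub_cancel' hk, hd]

/-- Occurs-before does not place own propagations before the read. Since neither buffer holds an
item for `x`, every own item for `x` written before `t` has been propagated both by time `t` and
within the cut. -/
theorem separates_of_readMem (hc : r.DownClosed c) (hc' : r.DownClosed c') (hs : CutStep c c' t)
    {j : Fin n} (hb : c (.proc j) = t) (hb' : c' (.proc j) = t + 1) {x : Var} {v : Val}
    (he : r.ev t (.proc j) = .RfM x v) (hbuf : ∀ d ∈ (r.tso t).buf j, d.var ≠ x)
    (hcut : ∀ d ∈ r.cutBuf c j, d.var ≠ x) : r.Separates c x t := by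
  refine separates_of_accesses hc hc' hs hb hb' (Or.inl ⟨v, he⟩) ?_
  rintro a u w hw ⟨i, rfl, hij, ⟨y, w', k, heu⟩, -⟩
  cases hij
  rw [heu, Event.memWrite, Option.some.injEq, Prod.mk.injEq] at hw
  obtain ⟨rfl, rfl⟩ := hw
  obtain ⟨hk, hget⟩ := r.props_eq_of_prop heu
  constructor
  · intro hut
    by_contra hcu
    push Not at hcu
    refine hcut ⟨y, w', k⟩ ?_ rfl
    rw [cutBuf, hb]
    exact mem_buf_of_getElem? (r.writes_getElem?_mono j hut.le hget)
      (hk ▸ r.props_mono j hcu)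
  · intro hcu
    by_contra hut
    push Not at hut
    refine hbuf ⟨y, w', k⟩ ?_ rfl
    obtain ⟨w, hw, hew⟩ := r.exists_write_of_prop heu
    have hwc := hc _ _ _ _ (.buffer j w u hw k (Or.inl ⟨y, w', hew⟩) ⟨y, w', heu⟩) hcu
    have hlt := r.lt_length_of_write hew hwc
    rw [hb] at hlt
    have h1 := List.getElem?_eq_getElem hlt
    rw [r.writes_getElem?_mono j hut h1] at hget
    rw [hget] at h1
    rw [buf_eq]
    exact mem_buf_of_getElem? h1 (hk ▸ r.props_mono j hut)

/-- If the own latest item for `x` is in the memory already in `r`, but still in the buffer after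
the events of the cut, then it holds the value of `x` in `r`. -/
theorem mem_eq_of_cutBuf_eq (hc' : r.DownClosed c') (hs : CutStep c c' t)
    {j : Fin n} (hb : c (.proc j) = t) (hb' : c' (.proc j) = t + 1) {v : Val}
    {d : Item Var Val} (he : r.ev t (.proc j) = .RfM d.var v)
    (hbuf : ∀ d' ∈ (r.tso t).buf j, d'.var ≠ d.var)
    {β₁ β₂ : List (Item Var Val)} (hcut : r.cutBuf c j = β₁ ++ d :: β₂)
    (hlast : ∀ d' ∈ β₂, d'.var ≠ d.var) : (r.tso t).mem d.var = d.val := by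
  set P := r.props j (c (.disp j))
  rw [cutBuf, hb] at hcut
  have hget : (r.writes j t)[P + β₁.length]? = some d := by
    rw [← List.getElem?_drop, hcut]; simp
  set p := P + β₁.length with hp
  have hpt : p < r.props j t := by
    by_contra hlt
    push Not at hlt
    refine hbuf d ?_ rfl
    rw [buf_eq]
    exact mem_buf_of_getElem? hget hlt
  -- `d` reached the memory of `r` at time `u`; it remains to show that nothing overwrites it before
  -- `t`.
  obtain ⟨u, hu, y, w, heu⟩ := r.exists_prop_of_lt hpt
  have hgu := r.writes_getElem?_mono j hu.le (r.props_eq_of_prop heu).2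
  rw [hget, Option.some.injEq] at hgu
  have hcu : ¬ u < c (.disp j) := by
    intro h
    have h2 := r.props_mono j (Nat.succ_le_of_lt h)
    rw [Nat.succ_eq_add_one, r.props_succ_of_prop heu] at h2
    omega
  have hyw : (r.ev u (.disp j)).memWrite = some (d.var, d.val) := by
    rw [heu, hgu]; rfl
  rw [r.mem_eq_of_forall (Nat.succ_le_of_lt hu), r.mem_succ_of_memWrite hyw]
  intro u' a w' h1 h2 h3
  -- An own later propagation to the variable would carry an item behind `d`, contrary to `hlast`.
  -- Any other store would lie between the propagation of `d` and the read in occurs-before, forcing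
  -- that propagation into the cut.
  by_cases ho : OwnPropRead a (r.ev u' a) (.proc j) (r.ev t (.proc j))
  · obtain ⟨i, rfl, hij, ⟨y', w'', k, heu'⟩, -⟩ := ho
    cases hij
    rw [heu', Event.memWrite, Option.some.injEq, Prod.mk.injEq] at h3
    obtain ⟨hk, hget'⟩ := r.props_eq_of_prop heu'
    have hpk := r.props_mono j h1
    rw [Nat.succ_eq_add_one, r.props_succ_of_prop heu] at hpk
    have hgt := r.writes_getElem?_mono j h2.le hget'
    refine hlast ⟨y', w'', k⟩ (List.mem_of_getElem? (i := k - p - 1) ?_) h3.1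
    have h4 : (β₁ ++ d :: β₂)[k - P]? = some ⟨y', w'', k⟩ := by
      rw [← hcut, List.getElem?_drop, ← hgt]
      congr 1
      omega
    rw [List.getElem?_append_right (by omega)] at h4
    have h5 : k - P - β₁.length = (k - p - 1) + 1 := by omega
    rwa [h5, List.getElem?_cons_succ] at h4
  · refine hcu (lt_of_occursBefore hc' hs hb' (.trans _ (a, u') _
      (.memory (.disp j) a u u' h1 d.var (Event.accesses_of_memWrite hyw)
        (Event.accesses_of_memWrite h3) (fun h => Event.not_isRfM_of_memWrite hyw h.1) ?_)
      (.memory a (.proc j) u' t h2 d.var (Event.accesses_of_memWrite h3) (Or.inl ⟨v, he⟩)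
        (fun h => Event.not_isRfM_of_memWrite h3 h.1) ho)))
    rintro ⟨_, _, _, _, h⟩
    exact Event.not_isRfM_of_memWrite h3 h

theorem cutEvent_enabled {σ : State n Var Val} (hσ : r.IsCutState c σ) (hc : r.DownClosed c)
    (hc' : r.DownClosed c') (hs : CutStep c c' t) (b : Agent n) :
    ∃ τ, Step σ b (r.cutEvent c c' b) τ := by
  rcases hs b with hb | ⟨hb, hb'⟩
  · rw [cutEvent_of_eq hb]
    exact ⟨_, .null _ _⟩
  obtain ⟨τ, hτ⟩ := r.enabled t b
  cases b with
  | disp j =>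
    rw [cutEvent_disp (by omega), hb]
    generalize he : r.ev t (.disp j) = e at hτ
    cases hτ with
    | propagate _ x v k β hbuf =>
      obtain ⟨β', hβ'⟩ := cutBuf_propagate hc' hs hb hb' he
      exact ⟨_, .propagate _ _ _ _ _ β' ((hσ.1 j).trans hβ')⟩
    | null => exact ⟨_, .null _ _⟩
  | proc j =>
    rw [cutEvent_proc (by omega), hb]
    generalize he : r.ev t (.proc j) = e at hτ
    cases hτ with
    | write _ x v k => exact ⟨_, .write _ _ _ _ _⟩
    | readBuf _ x v k β₁ β₂ hbuf hlast =>
      obtain ⟨β, hβ⟩ := cutBuf_readBuf hc hb he hbuf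
      exact ⟨_, .readBuf _ _ _ _ _ β β₂ ((hσ.1 j).trans hβ) hlast⟩
    | readMem _ x hbuf =>
      rcases hf : (r.cutBuf c j).reverse.find? (fun d => d.var = x) with _ | d
      · simp only [Event.resolve, hf]
        have hcut : ∀ d ∈ r.cutBuf c j, d.var ≠ x := by simpa using hf
        rw [← hσ.2 x t (separates_of_readMem hc hc' hs hb hb' he hbuf hcut)]
        exact ⟨_, .readMem _ _ _ (by rwa [hσ.1 j])⟩
      · simp only [Event.resolve, hf]
        obtain ⟨hd, l₁, l₂, hl, hl₁⟩ := List.find?_eq_some_iff_append.1 hf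
        have hdx : d.var = x := by simpa using hd
        have hl₁' : ∀ d' ∈ l₁.reverse, d'.var ≠ x := by simpa using hl₁
        subst hdx
        have hcut : r.cutBuf c j = l₂.reverse ++ d :: l₁.reverse := by
          rw [← List.reverse_reverse (r.cutBuf c j), hl]; simp
        rw [mem_eq_of_cutBuf_eq hc' hs hb hb' he hbuf hcut hl₁']
        exact ⟨_, .readBuf _ _ _ _ _ l₂.reverse l₁.reverse ((hσ.1 j).trans hcut) hl₁'⟩
    | rmw _ x vexp vnew hbuf hmem =>
      have hsync : (r.ev t (.proc j)).IsSync := Or.inr ⟨x, vexp, vnew, he⟩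
      refine ⟨_, .rmw _ _ _ _ _ ((hσ.1 j).trans (cutBuf_eq_nil hc' hs hb hb' hsync hbuf)) ?_⟩
      rw [hσ.2 x t, hmem]
      refine separates_of_accesses hc hc' hs hb hb' (Or.inr (Or.inl ⟨vexp, vnew, he⟩)) ?_
      rintro a u w - ⟨_, _, _, _, h⟩
      rw [he] at h
      obtain ⟨_, _, h⟩ := h
      cases h
    | fence _ hbuf =>
      exact ⟨_, .fence _ _ ((hσ.1 j).trans (cutBuf_eq_nil hc' hs hb hb' (Or.inl he) hbuf))⟩
    | ret _ o => exact ⟨_, .ret _ _ _⟩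
    | inner _ a => exact ⟨_, .inner _ _ _⟩
    | null => exact ⟨_, .null _ _⟩

end Cut

end Run
end TSO

namespace TSO

/-! ### Schedules and the runs they produce. -/

namespace Run

variable {n : ℕ} {Var Val Op Inn : Type*} [DecidableEq Var]

/-- A way to perform the events of a run in other rounds: in round `t + 1`, the events of `r` at
certain nodes of time `time t` are performed, and they extend `cut t` to `cut (t + 1)`. -/
structure Schedule (r : Run n Var Val Op Inn) where
  cut : ℕ → Agent n → ℕ
  time : ℕ → ℕ
  cut_zero : ∀ b, cut 0 b = 0
  cut_step : ∀ t, CutStep (cut t) (cut (t + 1)) (time t)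
  closed : ∀ t, r.DownClosed (cut t)

namespace Schedule

variable {r : Run n Var Val Op Inn} (S : r.Schedule)

theorem cut_succ (t : ℕ) (b : Agent n) :
    S.cut (t + 1) b = S.cut t b ∨ S.cut (t + 1) b = S.cut t b + 1 := by
  rcases S.cut_step t b with h | h
  · exact Or.inl h
  · omega

theorem cut_mono (b : Agent n) : Monotone fun t => S.cut t b :=
  monotone_nat_of_le_succ fun t => by rcases S.cut_succ t b with h | h <;> omega

theorem exists_cut_eq {b : Agent n} {u T : ℕ} (h : u < S.cut T b) :
    ∃ t < T, S.cut t b = u ∧ S.cut (t + 1) b = u + 1 := by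
  induction T with
  | zero => simp [S.cut_zero] at h
  | succ T ih =>
    by_cases hT : u < S.cut T b
    · obtain ⟨t, ht, h'⟩ := ih hT
      exact ⟨t, ht.trans (Nat.lt_succ_self T), h'⟩
    · refine ⟨T, Nat.lt_succ_self T, ?_⟩
      rcases S.cut_succ T b with h' | h' <;> omega

def ev (t : ℕ) : Agent n → Event Var Val Op Inn := r.cutEvent (S.cut t) (S.cut (t + 1))

def tso : ℕ → State n Var Val
  | 0 => r.tso 0
  | t + 1 => (tso t).round (S.ev t)

def inv (t : ℕ) (j : Fin n) : Option Op :=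
  if S.cut (t + 1) (.proc j) = S.cut t (.proc j) + 1 then r.inv (S.cut t (.proc j)) j else none

theorem isCutState (t : ℕ) : r.IsCutState (S.cut t) (S.tso t) := by
  induction t with
  | zero =>
    refine ⟨fun j => ?_, fun x T hT => ?_⟩
    · simp [tso, r.buf_zero, cutBuf, S.cut_zero, writes, props]
    · refine (r.mem_eq_of_forall (Nat.zero_le T) fun u b v _ hu hw => ?_).symm
      have := (hT b u v hw).1 hu
      simp [S.cut_zero] at this
  | succ t ih => exact ih.round (S.closed t) (S.closed (t + 1)) (S.cut_step t)

theorem cut_succ_of_ev {t : ℕ} {b : Agent n} (h : S.ev t b ≠ .null) :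
    S.cut (t + 1) b = S.cut t b + 1 :=
  (S.cut_succ t b).resolve_left fun h' => h (cutEvent_of_eq h')

theorem cut_succ_of_inv {t : ℕ} {j : Fin n} {o : Op} (h : S.inv t j = some o) :
    S.cut (t + 1) (.proc j) = S.cut t (.proc j) + 1 ∧ r.inv (S.cut t (.proc j)) j = some o := by
  unfold inv at h
  split at h
  · exact ⟨by assumption, h⟩
  · cases h

theorem ev_eq_ret_iff {t : ℕ} {j : Fin n}
    (h : S.cut (t + 1) (.proc j) = S.cut t (.proc j) + 1) (o : Op) :
    S.ev t (.proc j) = .ret o ↔ r.ev (S.cut t (.proc j)) (.proc j) = .ret o := by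
  rw [ev, cutEvent_proc h]
  rcases Event.resolve_cases (r.cutBuf (S.cut t) j) (r.ev (S.cut t (.proc j)) (.proc j)) with
    h | ⟨x, v, c, -, -, h, h'⟩
  · rw [h]
  · rw [h', h]; simp

theorem ev_eq_write_iff {t : ℕ} {j : Fin n}
    (h : S.cut (t + 1) (.proc j) = S.cut t (.proc j) + 1) (x : Var) (v : Val) (k : ℕ) :
    S.ev t (.proc j) = .W x v k ↔ r.ev (S.cut t (.proc j)) (.proc j) = .W x v k := by
  rw [ev, cutEvent_proc h]
  rcases Event.resolve_cases (r.cutBuf (S.cut t) j) (r.ev (S.cut t (.proc j)) (.proc j)) with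
    h | ⟨x, v, c, -, -, h, h'⟩
  · rw [h]
  · rw [h', h]; simp

theorem ev_eq_null_iff {t : ℕ} {j : Fin n}
    (h : S.cut (t + 1) (.proc j) = S.cut t (.proc j) + 1) :
    S.ev t (.proc j) = .null ↔ r.ev (S.cut t (.proc j)) (.proc j) = .null := by
  rw [ev, cutEvent_proc h]
  rcases Event.resolve_cases (r.cutBuf (S.cut t) j) (r.ev (S.cut t (.proc j)) (.proc j)) with
    h | ⟨x, v, c, -, -, h, h'⟩
  · rw [h]
  · rw [h', h]; simp

/-- The run that results from performing the events of `r` according to the schedule. -/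
def run : Run n Var Val Op Inn where
  tso := S.tso
  loc t j := r.loc (S.cut t (.proc j)) j
  ev := S.ev
  inv := S.inv
  buf_zero := r.buf_zero
  loc_zero j := by rw [S.cut_zero, r.loc_zero]
  enabled t b := cutEvent_enabled (S.isCutState t) (S.closed t) (S.closed (t + 1)) (S.cut_step t) b
  nonconflicting t a b hab := cutEvent_nonconflicting (S.cut_step t) hab
  read_not_propagated t j x v k y w h := cutEvent_read_not_propagated (S.cut_step t) h
  tag_write t j x v k h := by
    have hs := S.cut_succ_of_ev (t := t) (b := .proc j) (by rw [h]; simp)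
    exact r.tag_write _ j x v k ((S.ev_eq_write_iff hs x v k).1 h)
  tso_succ t := State.stepSeq_round (fun a b => cutEvent_nonconflicting (S.cut_step t)) _
    (cutEvent_enabled (S.isCutState t) (S.closed t) (S.closed (t + 1)) (S.cut_step t))
  loc_succ t j := by
    rcases S.cut_succ t (.proc j) with h | h
    · rw [h, ev, cutEvent_of_eq h, inv, if_neg (by omega)]
      simp [Event.records]
    · rw [h, r.loc_succ, ev, cutEvent_proc h, Event.resolve_records, inv, if_pos h]
  inv_alternate j t₁ t₂ o o₂ ht h₁ h₂ := by
    obtain ⟨hs₁, hi₁⟩ := S.cut_succ_of_inv h₁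
    obtain ⟨hs₂, hi₂⟩ := S.cut_succ_of_inv h₂
    have hm := S.cut_mono (.proc j) (Nat.succ_le_of_lt ht)
    simp only [Nat.succ_eq_add_one] at hm
    obtain ⟨u, hu₁, hu₂, hu⟩ := r.inv_alternate j _ _ o o₂ (by omega) hi₁ hi₂
    obtain ⟨w, hw, hwu, hwu'⟩ :=
      S.exists_cut_eq (b := .proc j) (u := u) (T := t₂ + 1) (by omega)
    refine ⟨w, ?_, Nat.lt_succ_iff.1 hw, (S.ev_eq_ret_iff (by omega) o).2 (hwu ▸ hu)⟩
    by_contra hle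
    have := S.cut_mono (.proc j) (not_lt.1 hle)
    simp only at this
    omega

theorem isRunOf_run {P : Protocol n Var Val Op Inn} (hP : r.IsRunOf P) : S.run.IsRunOf P := by
  intro t j h
  have hs := S.cut_succ_of_ev h
  have hact : (S.run.ev t (.proc j)).action = _ := cutEvent_action j hs
  rw [hact]
  exact hP _ j fun h' => h ((S.ev_eq_null_iff hs).2 h')

theorem locallyEquiv_run (hS : ∀ t b, ∃ t', S.cut t' b = t) : r.LocallyEquiv S.run := by
  intro j ℓ
  constructor
  · rintro ⟨t, rfl⟩
    obtain ⟨t', ht'⟩ := hS t (.proc j)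
    exact ⟨t', by simp only [run, ht']⟩
  · rintro ⟨t, rfl⟩
    exact ⟨_, rfl⟩

/-- A cut at equal times is the past of `T`, so it separates every variable at `T`. This lets the
new run rejoin `r`. -/
theorem tso_eq {t T : ℕ} (h : ∀ b, S.cut t b = T) : S.tso t = r.tso T := by
  obtain ⟨hb, hm⟩ := S.isCutState t
  refine State.ext' (fun x => hm x T fun b u v _ => by rw [h]) fun j => ?_
  rw [hb, buf_eq, cutBuf, h, h]

theorem buf_ne_nil_of_no_prop (r : Run n Var Val Op Inn) {j : Fin n} {t t' : ℕ} (htt' : t ≤ t')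
    (hb : (r.tso t).buf j ≠ []) (h : ∀ u, t ≤ u → ¬ (r.ev u (.disp j)).IsProp) :
    (r.tso t').buf j ≠ [] := by
  induction htt' with
  | refl => exact hb
  | @step m hm ih =>
    have h0 : (r.ev m (.disp j)).numProps = 0 := by
      have := h m hm
      cases he : r.ev m (.disp j) <;> simp_all [Event.numProps, Event.IsProp]
    rw [tso_succ_eq, State.round_buf, h0]
    simp [ih]

/-- A schedule that falls behind by a constant delay from some time on preserves fairness. -/
theorem fair_run {P : Protocol n Var Val Op Inn} {N δ : ℕ}
    (hS : ∀ t, N ≤ t → ∀ b, S.cut (t + δ) b = t) (hr : r.Fair P) : S.run.Fair P := by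
  have htso : ∀ t, N ≤ t → S.run.tso (t + δ) = r.tso t := fun t ht => S.tso_eq (hS t ht)
  have hloc : ∀ t j, N ≤ t → S.run.loc (t + δ) j = r.loc t j := fun t j ht => by
    simp only [run, hS t ht]
  have hstep : ∀ t b, N ≤ t → S.cut (t + δ + 1) b = S.cut (t + δ) b + 1 := fun t b ht => by
    rw [hS t ht, Nat.add_right_comm, hS _ (by omega)]
  constructor
  · intro j t hb
    by_contra hno
    push Not at hno
    -- Without propagations the buffer stays nonempty until the two runs agree up to the shift,
    -- where fairness of `r` applies.
    have h1 := buf_ne_nil_of_no_prop S.run (t' := max t N + δ)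
      (by omega) hb hno
    rw [htso _ (le_max_right t N)] at h1
    obtain ⟨u, hu, hp⟩ := hr.1 j _ h1
    refine hno (u + δ) (by omega) ?_
    have hev : S.run.ev (u + δ) (.disp j) = _ := cutEvent_disp (hstep u _ (by omega))
    rwa [hev, hS u (by omega)]
  · intro j t h
    obtain ⟨u, hu, hne⟩ := hr.2 j (max t N) fun u hu => by
      obtain ⟨a, ha, hnull, e, σ, he, hσ⟩ := h (u + δ) (by omega)
      rw [hloc u j (by omega)] at ha
      rw [htso u (by omega)] at hσ
      exact ⟨a, ha, hnull, e, σ, he, hσ⟩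
    refine ⟨u + δ, by omega, fun h0 => hne ?_⟩
    have := (S.ev_eq_null_iff (hstep u (.proc j) (by omega))).1 h0
    rwa [hS u (by omega)] at this

/-- The schedule that first performs the events of a down-closed cut `g` of nodes before time `e`
and then, with delay `e`, all the others. -/
def delay (g : Agent n → ℕ) (hg : r.DownClosed g) (e : ℕ) (hge : ∀ b, g b ≤ e) : r.Schedule where
  -- Subtraction is truncated: up to time `e` the first term governs. Afterwards `b` waits at `g b`
  -- until the delayed clock `t - e` catches up.
  cut t b := max (min t (g b)) (t - e)
  time t := if t < e then t else t - e
  cut_zero b := by simp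
  cut_step t b := by
    have := hge b
    dsimp only
    split <;> omega
  closed t b u b' u' h h' := by
    have h1 : u < u' := h.time_lt
    rcases lt_max_iff.1 h' with h2 | h2
    · rw [lt_min_iff] at h2
      exact lt_max_iff.2 (Or.inl (lt_min (h1.trans h2.1) (hg _ _ _ _ h h2.2)))
    · exact lt_max_iff.2 (Or.inr (h1.trans h2))

end Schedule

/-! ### The cut that avoids an up-closed set, and feedback loops. -/

theorem exists_cut_of_upClosed (r : Run n Var Val Op Inn) (D : Set (Agent n × ℕ))
    (hD : ∀ θ θ', r.OccursBefore θ θ' → θ ∈ D → θ' ∈ D) (e : ℕ) :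
    ∃ g : Agent n → ℕ, r.DownClosed g ∧ ∀ b t, t < g b ↔ t < e ∧ (b, t) ∉ D := by
  classical
  -- Each agent stops at its first node in `D` or at `e`; by locality all its later nodes are in `D`
  -- once one is.
  have hex : ∀ b, ∃ t, e ≤ t ∨ (b, t) ∈ D := fun b => ⟨e, Or.inl le_rfl⟩
  have hlt : ∀ b t, t < Nat.find (hex b) ↔ t < e ∧ (b, t) ∉ D := by
    intro b t
    rw [Nat.lt_find_iff]
    refine ⟨fun h => by simpa using h t le_rfl, fun h u hu => ?_⟩
    rintro (h' | h')
    · omega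
    · rcases hu.eq_or_lt with rfl | hu
      · exact h.2 h'
      · exact h.2 (hD _ _ (.locality b u t hu) h')
  refine ⟨fun b => Nat.find (hex b), fun b t b' t' h h' => ?_, hlt⟩
  have h1 : t < t' := h.time_lt
  simp only [hlt] at h' ⊢
  exact ⟨h1.trans h'.1, fun hm => h'.2 (hD _ _ h hm)⟩

/-- Without a feedback loop, a propagation by the dispatcher of `i` does not occur before a node
of `i` unless `i` synchronizes in between. -/
theorem not_occursBefore_of_not_feedbackLoop {r : Run n Var Val Op Inn} {i : Fin n} {s e p u : ℕ}
    (hloop : ¬ r.FeedbackLoop i s e) (hp : r.OccursBefore (.proc i, s) (.disp i, p)) (hu : u < e)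
    (hsync : ∀ t, p < t → t ≤ u → ¬ (r.ev t (.proc i)).IsSync) :
    ¬ r.OccursBefore (.disp i, p) (.proc i, u) := by
  -- `Q` describes what a chain from `⟨d_i, p⟩` can reach: it has met a third agent after `⟨i, s⟩`,
  -- or `i` has synchronized since `p`, or it is still at `d_i`.
  let Q : Agent n × ℕ → Prop := fun θ =>
    (∃ b t, b ≠ .proc i ∧ b ≠ .disp i ∧ r.OccursBefore (.proc i, s) (b, t) ∧
      ((b, t) = θ ∨ r.OccursBefore (b, t) θ)) ∨
    (∃ t, p < t ∧ t ≤ θ.2 ∧ (r.ev t (.proc i)).IsSync) ∨ (θ.1 = .disp i ∧ p ≤ θ.2)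
  have hQ : ∀ θ θ', r.OccursBefore θ θ' → Q θ → Q θ' := by
    intro θ θ' h hθ
    have hlt := h.time_lt
    rcases hθ with ⟨b, t, h1, h2, h3, h4⟩ | ⟨t, h1, h2, h3⟩ | ⟨h1, h2⟩
    · refine Or.inl ⟨b, t, h1, h2, h3, Or.inr ?_⟩
      rcases h4 with rfl | h4
      · exact h
      · exact .trans _ _ _ h4 h
    · exact Or.inr (Or.inl ⟨t, h1, h2.trans hlt.le, h3⟩)
    · induction h with
      | locality b t t' h => exact Or.inr (Or.inr ⟨h1, by simp only at *; omega⟩)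
      | buffer j t t' h k huse hprop => cases h1
      | sync j t t' h hprop hs =>
        cases h1
        exact Or.inr (Or.inl ⟨t', by simp only at *; omega, le_rfl, hs⟩)
      | memory b c t t' h x hb hc hreads hown =>
        simp only at h1 h2 hlt
        subst h1
        by_cases hci : c = .disp i
        · exact Or.inr (Or.inr ⟨hci, by simp only; omega⟩)
        by_cases hcp : c = .proc i
        · subst hcp
          have hprop : (r.ev t (.disp i)).IsProp := by
            obtain ⟨σ, hσ⟩ := r.enabled t (.disp i)
            generalize r.ev t (.disp i) = f at *
            cases hσ with
            | propagate _ x v k => exact ⟨_, _, _, rfl⟩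
            | null => simp [Event.Accesses] at hb
          refine Or.inr (Or.inl ⟨t', by omega, le_rfl, ?_⟩)
          rcases hc with ⟨v, hc⟩ | ⟨v, w, hc⟩ | ⟨v, k, hc⟩
          -- The exemption of own propagations in the memory clause is essential here: only an RMW
          -- leads from `d_i` directly to `i`.
          · exact absurd ⟨i, rfl, rfl, hprop, x, v, hc⟩ hown
          · exact Or.inr ⟨x, v, w, hc⟩
          · obtain ⟨σ, hσ⟩ := r.enabled t' (.proc i)
            rw [hc] at hσ
            cases hσ
        · refine Or.inl ⟨c, t', hcp, hci, ?_, Or.inl rfl⟩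
          have hmem := OccursBefore.memory (r := r) (.disp i) c t t' h x hb hc hreads hown
          rcases h2.eq_or_lt with rfl | h2
          · exact .trans _ _ _ hp hmem
          · exact .trans _ _ _ hp (.trans _ _ _ (.locality _ _ _ h2) hmem)
      | trans θ₀ θ₁ θ₂ h₁ h₂ ih₁ ih₂ =>
        rcases ih₁ h₁.time_lt h1 h2 with ⟨b, t, h1, h2, h3, h4⟩ | ⟨t, h1, h2, h3⟩ | ⟨h1, h2⟩
        · refine Or.inl ⟨b, t, h1, h2, h3, Or.inr ?_⟩
          rcases h4 with rfl | h4
          · exact h₂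
          · exact .trans _ _ _ h4 h₂
        · exact Or.inr (Or.inl ⟨t, h1, h2.trans h₂.time_lt.le, h3⟩)
        · exact ih₂ h₂.time_lt h1 h2
  intro h
  rcases hQ _ _ h (Or.inr (Or.inr ⟨rfl, le_rfl⟩)) with ⟨b, t, h1, h2, h3, h4⟩ | ⟨t, h1, h2, h3⟩ | h1
  · have hlast := OccursBefore.locality (r := r) (.proc i) u e hu
    rcases h4 with h4 | h4
    · exact h1 (congrArg Prod.fst h4)
    · exact hloop ⟨b, t, h1, h2, h3, .trans _ _ _ h4 hlast⟩
  · exact hsync t h1 h2 h3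
  · cases h1.1

end Run

end TSO

/-! ### Postponing the propagation of κ. -/

open TSO Run in
theorem mainTheorem3 {n : ℕ} {Var Val Op Inn : Type*} [DecidableEq Var]
    (P : TSO.Protocol n Var Val Op Inn) (r : TSO.Run n Var Val Op Inn) (hP : r.IsRunOf P)
    (i : Fin n) (m : ℕ) (o : Op) (s e : ℕ) (hX : r.OpOccurs i m o s e)
    (k : ℕ) (hwrite : ∃ t, s ≤ t ∧ t < e ∧ r.WritesTag i k t)
    (hloop : ¬ r.FeedbackLoop i s e)
    (hsync : ∀ t, s ≤ t → t < e → ¬ (r.ev t (.proc i)).IsSync) :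
    ∃ r' : TSO.Run n Var Val Op Inn,
      r'.IsRunOf P ∧ r.LocallyEquiv r' ∧ r'.tso 0 = r.tso 0 ∧ (r.Fair P → r'.Fair P) ∧
      ∃ s' e', r'.OpOccurs i m o s' e' ∧ (∃ t, s' ≤ t ∧ t < e' ∧ r'.WritesTag i k t) ∧
        ∀ t, t < e' → ¬ r'.PropagatesTag i k t := by
  classical
  by_cases hprop : ∃ p, r.PropagatesTag i k p
  swap
  · exact ⟨r, hP, fun _ _ => Iff.rfl, rfl, id, s, e, hX, hwrite, fun t _ h => hprop ⟨t, h⟩⟩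
  obtain ⟨t, hst, hte, x, v, ht⟩ := hwrite
  set p := Nat.find hprop
  have hpp : r.PropagatesTag i k p := Nat.find_spec hprop
  have htp : t < p := by
    obtain ⟨y, w, hy⟩ := hpp
    have h1 := r.tag_eq_length ht
    by_contra hle
    have h2 := (List.getElem?_eq_some_iff.1
      (r.writes_getElem?_mono i (not_lt.1 hle) (r.props_eq_of_prop hy).2)).1
    omega
  have hsp : r.OccursBefore (.proc i, s) (.disp i, p) := by
    have h1 : r.OccursBefore (.proc i, t) (.disp i, p) :=
      .buffer i t p htp k (Or.inl ⟨x, v, ht⟩) hpp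
    rcases hst.eq_or_lt with rfl | h
    · exact h1
    · exact .trans _ _ _ (.locality _ _ _ h) h1
  obtain ⟨g, hg, hgD⟩ := r.exists_cut_of_upClosed
    {θ | θ = (.disp i, p) ∨ r.OccursBefore (.disp i, p) θ} (by
      rintro θ θ' h (rfl | h')
      · exact Or.inr h
      · exact Or.inr (.trans _ _ _ h' h)) e
  have hge : ∀ b, g b ≤ e := fun b => by
    by_contra hlt
    exact lt_irrefl _ ((hgD b e).1 (not_le.1 hlt)).1
  -- No node of `i` before `e` is in `D`, so `i` runs on its original clock until `e`, and `X` keeps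
  -- its endpoints `s` and `e`.
  have hgi : ∀ u, u < e → u < g (.proc i) := fun u hu => (hgD _ _).2 ⟨hu, by
    rintro (h | h)
    · cases h
    · exact not_occursBefore_of_not_feedbackLoop hloop hsp hu
        (fun t' h1 h2 => hsync t' (by omega) (by omega)) h⟩
  set S := Schedule.delay g hg e hge
  have hcut : ∀ u b, S.cut u b = max (min u (g b)) (u - e) := fun _ _ => rfl
  have hlate : ∀ u, e ≤ u → ∀ b, S.cut (u + e) b = u := fun u hu b => by
    have := hge b
    rw [hcut]
    omega
  have hcuti : ∀ u, u ≤ e → S.cut u (.proc i) = u := fun u hu => by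
    rcases Nat.eq_zero_or_pos u with rfl | h
    · simp [hcut]
    · have := hgi (u - 1) (by omega)
      rw [hcut]
      omega
  have hact : ∀ u, u < e → S.cut (u + 1) (.proc i) = S.cut u (.proc i) + 1 := fun u hu => by
    rw [hcuti u hu.le, hcuti (u + 1) hu]
  refine ⟨S.run, S.isRunOf_run hP, S.locallyEquiv_run fun u b => ?_, rfl,
    S.fair_run hlate, s, e, ?_, ⟨t, hst, hte, x, v, ?_⟩, ?_⟩
  · obtain ⟨w, -, hw, -⟩ := S.exists_cut_eq (b := b) (u := u) (T := u + 1 + e + e)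
      (by rw [hcut]; omega)
    exact ⟨w, hw⟩
  · obtain ⟨h1, h2, u, rfl, hsu, hu, hmin⟩ := hX
    refine ⟨?_, ?_, u, rfl, hsu, ?_, fun w hw hwu => ?_⟩
    · change S.inv s i = some o
      rw [Schedule.inv, if_pos (hact s (by omega)), hcuti s (by omega), h1]
    · change (r.loc (S.cut s (.proc i)) i).numInvokes = m
      rw [hcuti s (by omega), h2]
    · exact (S.ev_eq_ret_iff (hact u (by omega)) o).2 (by rw [hcuti u (by omega), hu])
    · intro h
      have := (S.ev_eq_ret_iff (hact w (by omega)) o).1 h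
      rw [hcuti w (by omega)] at this
      exact hmin w hw hwu this
  · exact (S.ev_eq_write_iff (hact t hte) x v k).2 (by rw [hcuti t hte.le, ht])
  · rintro u hu ⟨y, w, hy⟩
    have hs := S.cut_succ_of_ev (t := u) (b := .disp i) (by
      intro h
      exact absurd (h.symm.trans hy) (by simp))
    have hy' : r.ev (S.cut u (.disp i)) (.disp i) = .prop y w k :=
      (cutEvent_disp hs).symm.trans hy
    -- This alone allows the dispatcher to be waiting at `g`; `hs` says that it moves, which before
    -- `e` requires its position to be below `g ≤ p`.
    have hpu : p ≤ S.cut u (.disp i) := Nat.find_min' hprop ⟨y, w, hy'⟩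
    have hpg : ¬ p < g (.disp i) := fun h => ((hgD _ _).1 h).2 (Or.inl rfl)
    rw [hcut, hcut] at hs
    rw [hcut] at hpu
    omega
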